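/- Let $\mathbb K$ be a field of characteristic $0$ and $n\ge 1$; put $\langle a,b\rangle=\sum_i a_ib_i$ for $a,b\in\mathbb Z^n$ and $e_1=(1,0,\dots,0)$. For a $\mathbb Z^n$-graded vector space $V$ let $T(V)=\bigoplus_{p\ge1}V^{\otimes p}$ with the coproduct $\Delta(v_1\otimes\dots\otimes v_p)=\sum_{I\sqcup J=\{1,\dots,p-1\},\,I\ne\emptyset}\varepsilon_V(I;J)\,V_I\bigotimes (V_J\otimes v_p)$ for homogeneous $v_\ell$, and let $\downarrow V$ be the space $V$ with grading $(\downarrow V)^\alpha=V^{\alpha+e_1}$. Here subsets of $\{1,\dots,p\}$ are listed in increasing order, $V_I=(v_{i_1},\dots,v_{i_{|I|}})$ (also used for the degree $\sum_{i\in I}\deg v_i$), $(-1)^{(I^1;\dots;I^s)}$ is the signature of the permutation $(I^1;\dots;I^s)\to I^1\cup\dots\cup I^s$, and $\varepsilon_V(I^1;\dots;I^s)$ is the Koszul sign of the corresponding rearrangement of the $v_i$ (exchanging $v,w$ gives $(-1)^{\langle v,w\rangle}$). A $\mathrm{Lod}_\infty$ algebra is a $\mathbb Z^n$-graded vector space $V$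 with a coderivation $Q$ of weight $e_1$ of $(T(\downarrow V),\Delta)$, i.e. a linear map of weight $e_1$ with $\Delta Q=(Q\otimes\mathrm{id}+\mathrm{id}\otimes Q)\Delta$ (where $(\mathrm{id}\otimes Q)(a\otimes b)=(-1)^{\langle e_1,a\rangle}a\otimes Qb$), such that $Q^2=0$. A $\mathrm{Lod}_\infty$ morphism $(V,Q)\to(V',Q')$ is a weight $0$ linear map $\mathcal F:T(\downarrow V)\to T(\downarrow V')$ with $\Delta\mathcal F=(\mathcal F\otimes\mathcal F)\Delta$ and $Q'\mathcal F=\mathcal FQ$. To a linear map $G:T(\downarrow V)\to T(\downarrow V')$ we associate the sequence of multilinear maps $g_p=\uparrow\circ\, G_p\circ\downarrow^{\otimes p}:V^{\times p}\to V'$, $p\ge1$, where $G_p$ is the corestriction $(\downarrow V)^{\otimes p}\to T(\downarrow V)\xrightarrow{G}T(\downarrow V')\to\downarrow V'$ and $\downarrow^{\otimes p}(v_1\otimes\dots\otimes v_p)=(-1)^{\sum_{s}\langle(p-s)e_1,v_s\rangle}\downarrow v_1\otimes\dots\otimes\downarrow v_p$. Write $\pi=(\pi_1,\pi_2,\dots)$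 and $\pi'$ for the sequences of $Q$ and $Q'$, and $f$ for that of $\mathcal F$. **Proposition.** Let $(V,\pi)$ and $(V',\pi')$ be $\mathrm{Lod}_\infty$ algebras. The assignment $\mathcal F\mapsto f=(f_1,f_2,\dots)$ is a bijection from the set of $\mathrm{Lod}_\infty$ morphisms $(V,\pi)\to(V',\pi')$ onto the set of sequences of multilinear maps $f_p:V^{\times p}\to V'$ of weight $(1-p)e_1$, $p\ge1$, such that for all $p\ge1$ and all homogeneous $v_1,\dots,v_p\in V$ $$\sum_{s=1}^{p}\ \sum_{\substack{I^1\sqcup\dots\sqcup I^s=\{1,\dots,p\}\\ I^1,\dots,I^s\ne\emptyset\\ \max I^1<\dots<\max I^s}}(-1)^{\omega}(-1)^{(I^1;\dots;I^s)}\varepsilon_V(I^1;\dots;I^s)\,\pi'_s\big(f_{|I^1|}(V_{I^1}),\dots,f_{|I^s|}(V_{I^s})\big)$$ $$=\sum_{\substack{I\sqcup J\sqcup K=\{1,\dots,p\},\ K\neq\emptyset\\ I,J<K}}(-1)^{\lambda}(-1)^{(J;I)}\varepsilon_V(I;J)\,f_{|I|+|K|}\big(V_I,\pi_{|J|+1}(V_J,v_{k_1}),V_{K\setminus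 k_1}\big),$$ where $I,J<K$ means that all elements of $I$ and $J$ are smaller than $k_1=\min K$, and $$\omega=\tfrac{s(s-1)}2+\sum_{1\le r\le s}(s-r)|I^r|+\sum_{2\le r\le s}\big\langle(|I^r|+1)e_1,\,V_{I^1}+\dots+V_{I^{r-1}}\big\rangle,\qquad \lambda=\big\langle(1+|J|)e_1,\,V_I+(p+1)e_1\big\rangle .$$ -/

import Mathlib

open scoped TensorProduct DirectSum

noncomputable section

namespace LodayInfinity

/-! ### Degrees and signs

Degrees live in `ℤⁿ = Fin n → ℤ`, and `⟨a, b⟩ = ∑ aᵢ bᵢ` is Mathlib's `a ⬝ᵥ b`.  A subset of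
`{1, …, p}` is a `Finset (Fin p)`; it is identified with the unshuffle listing it in increasing
order. -/

/-- `e₁ = (1, 0, …, 0) ∈ ℤⁿ`. -/
def e₁ {n : ℕ} [NeZero n] : Fin n → ℤ := Pi.single 0 1

/-- The inversions of the concatenation `(B₁; …; B_s)` of disjoint unshuffles: the pairs
`(i, j)` with `i < j` such that `j` stands in an earlier block than `i`. -/
def inversions {p s : ℕ} (B : Fin s → Finset (Fin p)) : Finset (Fin p × Fin p) :=
  Finset.univ.filter fun x => x.1 < x.2 ∧ ∃ r r', r < r' ∧ x.2 ∈ B r ∧ x.1 ∈ B r'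

/-- The sign `(-1)^{(B₁; …; B_s)}`: the signature of `(B₁; …; B_s) → B₁ ∪ … ∪ B_s`. -/
def signature {p s : ℕ} (B : Fin s → Finset (Fin p)) : ℤ := (-1) ^ (inversions B).card

/-- The exponent of the Koszul sign of `V_{(B₁; …; B_s)} → V_{B₁ ∪ … ∪ B_s}` for homogeneous
vectors `v_i` of degree `d i`. -/
def koszulExponent {n p s : ℕ} (d : Fin p → Fin n → ℤ) (B : Fin s → Finset (Fin p)) : ℤ :=
  ∑ x ∈ inversions B, d x.1 ⬝ᵥ d x.2

/-- The subtuple `V_I` of `(v₁, …, v_p)`, in increasing order of the indices. -/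
def sub {V : Type*} {p : ℕ} (v : Fin p → V) (I : Finset (Fin p)) : Fin I.card → V :=
  fun t => v (I.orderEmbOfFin rfl t)

section Graded

variable {K : Type*} [Field K] {n : ℕ}
  {V : Type*} [AddCommGroup V] [Module K V]
  {V' : Type*} [AddCommGroup V'] [Module K V']
  {W : Type*} [AddCommMonoid W] [Module K W]

/-- The multilinear map which is `φ d` on `V^{d₁} × ⋯ × V^{d_p}`. -/
def gradedLift (𝒱 : (Fin n → ℤ) → Submodule K V) [DirectSum.Decomposition 𝒱] {p : ℕ}
    (φ : (Fin p → Fin n → ℤ) → MultilinearMap K (fun _ : Fin p => V) W) :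
    MultilinearMap K (fun _ : Fin p => V) W :=
  (MultilinearMap.fromDirectSumEquiv (R := K) (κ := fun _ : Fin p => Fin n → ℤ)
      (M := fun _ α => 𝒱 α) fun d => (φ d).compLinearMap fun i => (𝒱 (d i)).subtype).compLinearMap
    fun _ => (DirectSum.decomposeLinearEquiv 𝒱).toLinearMap

theorem gradedLift_apply (𝒱 : (Fin n → ℤ) → Submodule K V) [DirectSum.Decomposition 𝒱] {p : ℕ}
    (φ : (Fin p → Fin n → ℤ) → MultilinearMap K (fun _ : Fin p => V) W)
    (d : Fin p → Fin n → ℤ) (v : Fin p → V) (hv : ∀ i, v i ∈ 𝒱 (d i)) :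
    gradedLift 𝒱 φ v = φ d v := by
  have h : (fun i => DirectSum.decomposeLinearEquiv 𝒱 (v i)) =
      fun i => DirectSum.lof K (Fin n → ℤ) (fun α => 𝒱 α) (d i) ⟨v i, hv i⟩ := by
    funext i
    exact DirectSum.decompose_of_mem 𝒱 (hv i)
  simp only [gradedLift, MultilinearMap.compLinearMap_apply, LinearEquiv.coe_coe]
  rw [h, MultilinearMap.fromDirectSumEquiv_lof]
  simp

/-! ### The reduced tensor coalgebra -/

variable (K V) in
/-- The reduced tensor space `T(V) = ⨁_{p ≥ 1} V^{⊗p}`; the summand of index `p` is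
`V^{⊗(p+1)}`. -/
abbrev T : Type _ := ⨁ p : ℕ, ⨂[K]^(p + 1) V

variable (K V) in
/-- `word m (v₁, …, v_m) = v₁ ⊗ ⋯ ⊗ v_m ∈ T(V)` for `m ≥ 1`; the value for `m = 0` is a dummy. -/
def word : (m : ℕ) → MultilinearMap K (fun _ : Fin m => V) (T K V)
  | 0 => 0
  | p + 1 => (DirectSum.lof K ℕ (fun p => ⨂[K]^(p + 1) V) p).compMultilinearMap
      (PiTensorProduct.tprod K)

/-- The linear map on `T(V)` given on each `V^{⊗(p+1)}` by a multilinear map. -/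
def tlift (g : (p : ℕ) → MultilinearMap K (fun _ : Fin (p + 1) => V) W) : T K V →ₗ[K] W :=
  DirectSum.toModule K ℕ W fun p => PiTensorProduct.lift (g p)

/-- The canonical projection `pr : T(V) → V`. -/
def pr : T K V →ₗ[K] V :=
  (PiTensorProduct.subsingletonEquiv (R := K) (s := fun _ : Fin 1 => V) 0).toLinearMap ∘ₗ
    DirectSum.component K ℕ (fun p => ⨂[K]^(p + 1) V) 0

/-- The degree `α` part of the `ℤⁿ`-grading of `T(V)` induced by a grading of `V`. -/
def gradeT (𝒱 : (Fin n → ℤ) → Submodule K V) (α : Fin n → ℤ) : Submodule K (T K V) :=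
  Submodule.span K {x | ∃ (p : ℕ) (d : Fin (p + 1) → Fin n → ℤ) (v : Fin (p + 1) → V),
    (∀ i, v i ∈ 𝒱 (d i)) ∧ ∑ i, d i = α ∧ word K V (p + 1) v = x}

/-- `v ↦ V_I ⊠ V_{Iᶜ} ∈ T(V) ⊗ T(V)`. -/
def splitWord {p : ℕ} (I : Finset (Fin p)) :
    MultilinearMap K (fun _ : Fin p => V) (T K V ⊗[K] T K V) :=
  ((word K V I.card).domCoprod (word K V Iᶜ.card)).domDomCongr (finSumEquivOfFinset rfl rfl)

theorem splitWord_apply {p : ℕ} (I : Finset (Fin p)) (v : Fin p → V) :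
    splitWord (K := K) I v =
      word K V I.card (sub v I) ⊗ₜ[K] word K V Iᶜ.card (sub v Iᶜ) := rfl

/-- The coproduct
`Δ(v₁ ⊗ ⋯ ⊗ v_p) = ∑_{I ∪ J = {1, …, p-1}, I ≠ ∅} ε(I; J) V_I ⊠ (V_J ⊗ v_p)` of `T(V)`.
Here `J ∪ {p}` is the complement of `I`, and `ε(I; J) = ε(I; J ∪ {p})` as `p` comes last. -/
def coproduct (𝒱 : (Fin n → ℤ) → Submodule K V) [DirectSum.Decomposition 𝒱] :
    T K V →ₗ[K] T K V ⊗[K] T K V :=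
  tlift fun p => gradedLift 𝒱 fun d =>
    ∑ I ∈ Finset.univ.filter (fun I : Finset (Fin (p + 1)) => I.Nonempty ∧ Fin.last p ∉ I),
      (-1 : K) ^ koszulExponent d ![I, Iᶜ] • splitWord I

/-- The linear map `a ↦ (-1)^{⟨w, a⟩} a` of `T(V)`. -/
def signTwist (𝒱 : (Fin n → ℤ) → Submodule K V) [DirectSum.Decomposition 𝒱] (w : Fin n → ℤ) :
    T K V →ₗ[K] T K V :=
  tlift fun p => gradedLift 𝒱 fun d => (-1 : K) ^ (w ⬝ᵥ ∑ i, d i) • word K V (p + 1)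

/-- A linear map `T(V) → T(V')` has weight `w`. -/
def HasWeight (𝒱 : (Fin n → ℤ) → Submodule K V) (𝒱' : (Fin n → ℤ) → Submodule K V')
    (w : Fin n → ℤ) (G : T K V →ₗ[K] T K V') : Prop :=
  ∀ α, ∀ x ∈ gradeT 𝒱 α, G x ∈ gradeT 𝒱' (α + w)

/-- Weight `w` coderivations of `(T(V), Δ)`: `Δ Q = (Q ⊗ id + id ⊗ Q) Δ`, with the Koszul
convention `(id ⊗ Q)(a ⊗ b) = (-1)^{⟨w, a⟩} a ⊗ Q b`. -/
structure IsCoderivation (𝒱 : (Fin n → ℤ) → Submodule K V) [DirectSum.Decomposition 𝒱]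
    (w : Fin n → ℤ) (Q : T K V →ₗ[K] T K V) : Prop where
  hasWeight : HasWeight 𝒱 𝒱 w Q
  coLeibniz : coproduct 𝒱 ∘ₗ Q =
    (TensorProduct.map Q LinearMap.id + TensorProduct.map (signTwist 𝒱 w) Q) ∘ₗ coproduct 𝒱

/-- Cohomomorphisms `(T(V), Δ) → (T(V'), Δ)`: weight `0` linear maps with `Δ F = (F ⊗ F) Δ`. -/
structure IsCohomomorphism (𝒱 : (Fin n → ℤ) → Submodule K V) [DirectSum.Decomposition 𝒱]
    (𝒱' : (Fin n → ℤ) → Submodule K V') [DirectSum.Decomposition 𝒱']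
    (F : T K V →ₗ[K] T K V') : Prop where
  hasWeight : HasWeight 𝒱 𝒱' 0 F
  map_coproduct : coproduct 𝒱' ∘ₗ F = TensorProduct.map F F ∘ₗ coproduct 𝒱

/-! ### Desuspension -/

variable [NeZero n]

/-- The desuspension `↓V`: the same space, with the grading `(↓V)^α = V^{α + e₁}`. The maps
`↓ : V → ↓V` and `↑ : ↓V → V` are the identity on vectors. -/
def desusp (𝒱 : (Fin n → ℤ) → Submodule K V) : (Fin n → ℤ) → Submodule K V :=
  fun α => 𝒱 (α + e₁)

instance desuspDecomposition (𝒱 : (Fin n → ℤ) → Submodule K V) [DirectSum.Decomposition 𝒱] :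
    DirectSum.Decomposition (desusp 𝒱) :=
  DirectSum.IsInternal.chooseDecomposition _ <| by
    have h := DirectSum.Decomposition.isInternal 𝒱
    rw [DirectSum.isInternal_submodule_iff_iSupIndep_and_iSup_eq_top] at h ⊢
    refine ⟨h.1.comp (f := fun α => α + e₁) (add_left_injective _), ?_⟩
    rw [← h.2]
    exact (Equiv.addRight (e₁ : Fin n → ℤ)).iSup_comp (g := 𝒱)

/-- `↓^{⊗p}`, as a multilinear map:
`(v₁, …, v_p) ↦ (-1)^{∑ₛ ⟨(p - s) e₁, v_s⟩} ↓v₁ ⊗ ⋯ ⊗ ↓v_p ∈ T(↓V)`. -/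
def desuspWord (𝒱 : (Fin n → ℤ) → Submodule K V) [DirectSum.Decomposition 𝒱] (p : ℕ) :
    MultilinearMap K (fun _ : Fin p => V) (T K V) :=
  gradedLift 𝒱 fun d =>
    (-1 : K) ^ (∑ s : Fin p, (((p : ℤ) - ((s : ℤ) + 1)) • (e₁ : Fin n → ℤ)) ⬝ᵥ d s) • word K V p

variable (K V V') in
/-- Sequences `f = (f₁, f₂, …)` of multilinear maps `f_p : V^{×p} → V'`, `p ≥ 1`; the entry of
index `p` is `f_{p+1}`. -/
abbrev MultiSeq : Type _ := (p : ℕ) → MultilinearMap K (fun _ : Fin (p + 1) => V) V'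

/-- `ev f m (v₁, …, v_m) = f_m(v₁, …, v_m)` for `m ≥ 1`; the value for `m = 0` is a dummy. -/
def ev (f : MultiSeq K V V') : (m : ℕ) → (Fin m → V) → V'
  | 0, _ => 0
  | p + 1, v => f p v

/-- The sequence `↑ ∘ G_p ∘ ↓^{⊗p}`, `p ≥ 1`, of a linear map `G : T(↓V) → T(↓V')`, where `G_p` is
the corestriction `V^{⊗p} → T(↓V) → T(↓V') → ↓V'`. -/
def toSeq (𝒱 : (Fin n → ℤ) → Submodule K V) [DirectSum.Decomposition 𝒱]
    (G : T K V →ₗ[K] T K V') : MultiSeq K V V' :=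
  fun p => (pr ∘ₗ G).compMultilinearMap (desuspWord 𝒱 (p + 1))

/-- `f_p` has weight `(1 - p) e₁` for all `p ≥ 1`. -/
def HasSeqWeight (𝒱 : (Fin n → ℤ) → Submodule K V) (𝒱' : (Fin n → ℤ) → Submodule K V')
    (f : MultiSeq K V V') : Prop :=
  ∀ (p : ℕ) (d : Fin (p + 1) → Fin n → ℤ) (v : Fin (p + 1) → V), (∀ i, v i ∈ 𝒱 (d i)) →
    f p v ∈ 𝒱' (∑ i, d i + (1 - ((p : ℤ) + 1)) • e₁)

/-! ### Loday infinity algebras and morphisms -/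

/-- A `Lod_∞` structure on `V`: a weight `e₁` codifferential of `(T(↓V), Δ)`. -/
structure LodStructure (𝒱 : (Fin n → ℤ) → Submodule K V) [DirectSum.Decomposition 𝒱] where
  Q : T K V →ₗ[K] T K V
  isCoderivation : IsCoderivation (desusp 𝒱) e₁ Q
  sq_eq_zero : Q ∘ₗ Q = 0

/-- The structure maps `π = (π₁, π₂, …)` of a `Lod_∞` structure. -/
def LodStructure.π {𝒱 : (Fin n → ℤ) → Submodule K V} [DirectSum.Decomposition 𝒱]
    (L : LodStructure 𝒱) : MultiSeq K V V := toSeq 𝒱 L.Q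

/-- `Lod_∞` morphisms: cohomomorphisms `F : (T(↓V), Δ) → (T(↓V'), Δ)` with `Q' F = F Q`. -/
structure IsLodMorphism {𝒱 : (Fin n → ℤ) → Submodule K V} [DirectSum.Decomposition 𝒱]
    {𝒱' : (Fin n → ℤ) → Submodule K V'} [DirectSum.Decomposition 𝒱']
    (L : LodStructure 𝒱) (L' : LodStructure 𝒱') (F : T K V →ₗ[K] T K V') : Prop where
  isCohomomorphism : IsCohomomorphism (desusp 𝒱) (desusp 𝒱') F
  intertwines : L'.Q ∘ₗ F = F ∘ₗ L.Q

/-! ### The sequence identities -/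

/-- The `s`-tuples `(I¹, …, I^s)` of nonempty, pairwise disjoint unshuffles with
`I¹ ∪ ⋯ ∪ I^s = {1, …, p}` whose last elements satisfy `i¹_{|I¹|} < ⋯ < i^s_{|I^s|}`. -/
def blocks (p s : ℕ) : Finset (Fin s → Finset (Fin p)) :=
  Finset.univ.filter fun I =>
    (∀ r, (I r).Nonempty) ∧ (∀ r r', r ≠ r' → Disjoint (I r) (I r')) ∧
    (∀ i, ∃ r, i ∈ I r) ∧ (∀ r r', r < r' → (I r).max < (I r').max)

/-- `ω = s(s-1)/2 + ∑_{1≤r≤s} (s-r)|I^r| + ∑_{2≤r≤s} ⟨(|I^r|+1)e₁, V_{I¹} + ⋯ + V_{I^{r-1}}⟩`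
(the term `r = 1` of the last sum is zero). -/
def omega {p s : ℕ} (d : Fin p → Fin n → ℤ) (I : Fin s → Finset (Fin p)) : ℤ :=
  (s : ℤ) * ((s : ℤ) - 1) / 2 + ∑ r : Fin s, ((s : ℤ) - ((r : ℤ) + 1)) * ((I r).card : ℤ) +
    ∑ r : Fin s, ((((I r).card : ℤ) + 1) • (e₁ : Fin n → ℤ)) ⬝ᵥ
      ∑ q ∈ Finset.univ.filter (fun q : Fin s => q < r), ∑ i ∈ I q, d i

/-- `λ = ⟨(1 + |J|)e₁, V_I + (p + 1)e₁⟩`. -/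
def lambda {p : ℕ} (d : Fin p → Fin n → ℤ) (I J : Finset (Fin p)) : ℤ :=
  ((1 + (J.card : ℤ)) • (e₁ : Fin n → ℤ)) ⬝ᵥ (∑ i ∈ I, d i + ((p : ℤ) + 1) • e₁)

/-- `∑_{s=1}^p ∑_{(I¹, …, I^s)} (-1)^ω (-1)^{(I¹; …; I^s)} ε_V(I¹; …; I^s)
  π'_s(f_{|I¹|}(V_{I¹}), …, f_{|I^s|}(V_{I^s}))`. -/
def lhs (f : MultiSeq K V V') (π' : MultiSeq K V' V') {p : ℕ} (d : Fin p → Fin n → ℤ)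
    (v : Fin p → V) : V' :=
  ∑ s ∈ Finset.Icc 1 p, ∑ I ∈ blocks p s,
    ((-1 : K) ^ omega d I * (signature I : K) * (-1 : K) ^ koszulExponent d I) •
      ev π' s fun r => ev f (I r).card (sub v (I r))

/-- `∑_{I ∪ J ∪ K = {1, …, p}, I, J < K} (-1)^λ (-1)^{(J; I)} ε_V(I; J)
  f_{|I|+|K|}(V_I, π_{|J|+1}(V_J, v_{k₁}), V_{K ∖ k₁})`.
The condition `I, J < K` means that `K = {k₁, …, p}` and `I ⊔ J = {1, …, k₁ - 1}`, so the sum runs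
over `k = k₁` and over the subsets `I` of `{i | i < k}`, with `J = {i | i < k} ∖ I` and
`K ∖ k₁ = {i | k < i}`. -/
def rhs (f : MultiSeq K V V') (π : MultiSeq K V V) {p : ℕ} (d : Fin p → Fin n → ℤ)
    (v : Fin p → V) : V' :=
  ∑ k : Fin p, ∑ I ∈ (Finset.Iio k).powerset,
    ((-1 : K) ^ lambda d I (Finset.Iio k \ I) * (signature ![Finset.Iio k \ I, I] : K) *
        (-1 : K) ^ koszulExponent d ![I, Finset.Iio k \ I]) •
      ev f (I.card + 1 + (Finset.Ioi k).card)
        (Fin.append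
          (Fin.append (sub v I)
            ![ev π ((Finset.Iio k \ I).card + 1) (Fin.append (sub v (Finset.Iio k \ I)) ![v k])])
          (sub v (Finset.Ioi k)))

/-- The family of identities for a sequence `f`, for all `p ≥ 1` and all homogeneous vectors. -/
def SatisfiesIdentities (𝒱 : (Fin n → ℤ) → Submodule K V) (f : MultiSeq K V V')
    (π : MultiSeq K V V) (π' : MultiSeq K V' V') : Prop :=
  ∀ p : ℕ, 1 ≤ p → ∀ (d : Fin p → Fin n → ℤ) (v : Fin p → V), (∀ i, v i ∈ 𝒱 (d i)) →
    lhs f π' d v = rhs f π d v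

end Graded

end LodayInfinity

end

namespace LodayInfinity

/-! ### Signs -/

section Signs

/-! The coalgebra `T(V)` behaves as a cofree object: a weight `0` cohomomorphism is the same thing
as its corestriction `φ = pr ∘ F`, and any degree-preserving `φ` occurs. The reason is that an
element can be rebuilt from its one-letter part and its coproduct: `x = incl (pr x) + concat ((id ⊗
pr) (Δ x))` (`incl_pr_add_concat_coproduct`). Applied to `F x`, this gives the recursion `F = incl ∘
φ + concat ∘ (F ⊗ φ) ∘ Δ`. The first factors occurring in `Δ` of a word are strictly shorter than
the word, so the recursion has exactly one solution, by induction on length. That the solution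
`cohomLift` respects `Δ` follows from the formula `Δ(x ⊗ a) = x ⊠ a + (id ⊠ (· ⊗ a)) (Δ x + τ Δ x)`,
with `τ` the signed exchange (`coproduct_snocT`): both `Δ F` and `(F ⊗ F) Δ` of a word become the
same sum over splittings into two and three subwords.

The condition `Q' F = F Q` also needs checking only after `pr`. The difference `D = Q' F - F Q`
satisfies `Δ D = (D ⊗ F + F σ ⊗ D) Δ`, where `σ` is the sign twist by `e₁`. If `pr D = 0`,
rebuilding `D` gives `D = concat ∘ (D ⊗ pr F) ∘ Δ`, which forces `D = 0` by the same induction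
(`IsCohomomorphism.intertwines`).

It remains to read `pr Q' F = pr F Q` on homogeneous words. Unrolling the recursions writes `F` as a
sum over tuples of blocks with increasing last elements, and `Q` as a sum over the last letter
absorbed by its corestriction (the two `apply_subWord` lemmas). Passing from corestrictions on `↓V`
to multilinear maps on `V` introduces desuspension signs. Computed modulo 2 in `sign_lhs` and
`sign_rhs`, they turn the two sides into those of the required identity, up to one common sign
depending only on the degrees of the letters. -/

theorem neg_one_zpow_congr {K : Type*} [Field K] {a b : ℤ} (h : (a : ZMod 2) = b) :
    (-1 : K) ^ a = (-1 : K) ^ b := by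
  obtain ⟨c, hc⟩ := (ZMod.intCast_eq_intCast_iff_dvd_sub a b 2).1 h
  obtain rfl : b = a + 2 * c := by push_cast at hc; linarith
  rw [zpow_add₀ (by simp), zpow_mul]
  simp

theorem neg_one_zpow_add {K : Type*} [Field K] (a b : ℤ) :
    (-1 : K) ^ (a + b) = (-1 : K) ^ a * (-1 : K) ^ b :=
  zpow_add₀ (by simp) a b

/-! ### Inversion sums between blocks. -/

variable {ι : Type*} [LinearOrder ι] {A : Type*} [AddCommMonoid A]

/-- The sum of `β i j` over the inversions of the concatenation `(I; J)`, i.e. over the pairs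
`i ∈ I`, `j ∈ J` with `j < i`. -/
def crossing (β : ι → ι → A) (I J : Finset ι) : A :=
  ∑ i ∈ I, ∑ j ∈ J, if j < i then β i j else 0

@[simp] theorem crossing_empty_left (β : ι → ι → A) (J : Finset ι) : crossing β ∅ J = 0 := by
  simp [crossing]

@[simp] theorem crossing_empty_right (β : ι → ι → A) (I : Finset ι) : crossing β I ∅ = 0 := by
  simp [crossing]

theorem crossing_union_left (β : ι → ι → A) {I I' : Finset ι} (h : Disjoint I I')
    (J : Finset ι) : crossing β (I ∪ I') J = crossing β I J + crossing β I' J := by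
  simp [crossing, Finset.sum_union h]

theorem crossing_union_right (β : ι → ι → A) (I : Finset ι) {J J' : Finset ι}
    (h : Disjoint J J') : crossing β I (J ∪ J') = crossing β I J + crossing β I J' := by
  simp [crossing, Finset.sum_union h, Finset.sum_add_distrib]

/-- A letter to the right of all of `I` is never inverted with it. Hence attaching the last letter
to the second factor of a splitting leaves the Koszul sign unchanged. -/
theorem crossing_insert_of_lt (β : ι → ι → A) {I J : Finset ι} {m : ι} (hm : m ∉ J)
    (h : ∀ i ∈ I, i < m) : crossing β I (insert m J) = crossing β I J := by
  refine Finset.sum_congr rfl fun i hi => ?_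
  rw [Finset.sum_insert hm, if_neg (h i hi).not_gt, zero_add]

theorem crossing_map {κ : Type*} [LinearOrder κ] (f : κ ↪o ι) (β : ι → ι → A)
    (I J : Finset κ) :
    crossing β (I.map f.toEmbedding) (J.map f.toEmbedding) =
      crossing (fun i j => β (f i) (f j)) I J := by
  simp [crossing]

/-- Each pair is inverted in exactly one of the two orders `(I; J)` and `(J; I)`. Modulo 2,
exchanging two blocks therefore changes the sign exponent by the full pairing of the blocks. -/
theorem crossing_add_crossing (β : ι → ι → A) (hβ : ∀ i j, β i j = β j i) {I J : Finset ι}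
    (h : Disjoint I J) :
    crossing β I J + crossing β J I = ∑ i ∈ I, ∑ j ∈ J, β i j := by
  rw [crossing, crossing, Finset.sum_comm (s := J), ← Finset.sum_add_distrib]
  refine Finset.sum_congr rfl fun i hi => ?_
  rw [← Finset.sum_add_distrib]
  refine Finset.sum_congr rfl fun j hj => ?_
  rcases lt_trichotomy i j with hij | hij | hij
  · simp [hij, hij.not_gt, hβ i j]
  · exact absurd (hij ▸ hi) (Finset.disjoint_right.1 h hj)
  · simp [hij, hij.not_gt]

/-- The sum of `β j i` over the inversions `(i, j)` of the concatenation of a tuple of blocks. -/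
def invSum {p s : ℕ} (β : Fin p → Fin p → A) (B : Fin s → Finset (Fin p)) : A :=
  ∑ x ∈ inversions B, β x.2 x.1

/-- The new inversions are those between the last block `J` and the union `I` of the earlier ones.
Signs of `s`-tuples thereby reduce inductively to two-block crossings. -/
theorem invSum_snoc {p s : ℕ} (β : Fin p → Fin p → A) (B : Fin s → Finset (Fin p))
    (I J : Finset (Fin p)) (hI : ∀ i, i ∈ I ↔ ∃ r, i ∈ B r) (h : Disjoint I J) :
    invSum β (Fin.snoc B J : Fin (s + 1) → Finset (Fin p)) = invSum β B + crossing β I J := by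
  have hunion : inversions (Fin.snoc B J : Fin (s + 1) → Finset (Fin p)) =
      inversions B ∪ (J ×ˢ I).filter (fun x => x.1 < x.2) := by
    ext x
    simp only [inversions, Finset.mem_union, Finset.mem_filter, Finset.mem_univ, true_and,
      Finset.mem_product, hI, Fin.exists_fin_succ', Fin.snoc_castSucc, Fin.snoc_last,
      Fin.castSucc_lt_castSucc_iff, Fin.castSucc_lt_last, lt_irrefl, false_and, or_false,
      Fin.not_lt.2 (Fin.le_last _), exists_false]
    grind
  have hdisj : Disjoint (inversions B) ((J ×ˢ I).filter (fun x => x.1 < x.2)) := by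
    refine Finset.disjoint_left.2 fun x hx hx' => ?_
    obtain ⟨_, r, r', _, _, hr'⟩ := (Finset.mem_filter.1 hx).2
    exact Finset.disjoint_left.1 h ((hI _).2 ⟨r', hr'⟩)
      (Finset.mem_product.1 (Finset.mem_filter.1 hx').1).1
  rw [invSum, hunion, Finset.sum_union hdisj, Finset.sum_filter, Finset.sum_product_right]
  rfl

theorem koszulExponent_eq_invSum {n p s : ℕ} (d : Fin p → Fin n → ℤ)
    (B : Fin s → Finset (Fin p)) :
    koszulExponent d B = invSum (fun i j => d i ⬝ᵥ d j) B :=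
  Finset.sum_congr rfl fun _ _ => dotProduct_comm _ _

theorem invSum_fin_one {p : ℕ} (β : Fin p → Fin p → A) (B : Fin 1 → Finset (Fin p)) :
    invSum β B = 0 := by
  have : inversions B = ∅ := by
    refine Finset.filter_false_of_mem fun x _ h => ?_
    obtain ⟨_, r, r', hr, _⟩ := h
    omega
  simp [invSum, this]

theorem invSum_pair {p : ℕ} (β : Fin p → Fin p → A) {I J : Finset (Fin p)} (h : Disjoint I J) :
    invSum β ![I, J] = crossing β I J := by
  have : ![I, J] = (Fin.snoc ![I] J : Fin 2 → Finset (Fin p)) := by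
    ext r : 1
    fin_cases r <;> rfl
  rw [this, invSum_snoc β ![I] I J (by simp) h, invSum_fin_one, zero_add]

end Signs

/-! ### Words indexed by finite sets -/

section Words

variable {K : Type*} [Field K] {n : ℕ}
  {V : Type*} [AddCommGroup V] [Module K V]
  {W : Type*} [AddCommMonoid W] [Module K W]

/-! ### Homogeneous extensionality and words of lists. -/

theorem multilinear_ext_homogeneous (𝒱 : (Fin n → ℤ) → Submodule K V)
    [DirectSum.Decomposition 𝒱] {p : ℕ} {f g : MultilinearMap K (fun _ : Fin p => V) W}
    (h : ∀ (d : Fin p → Fin n → ℤ) (v : Fin p → V), (∀ i, v i ∈ 𝒱 (d i)) → f v = g v) :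
    f = g := by
  have key : f.compLinearMap (fun _ => (DirectSum.decomposeLinearEquiv 𝒱).symm.toLinearMap) =
      g.compLinearMap (fun _ => (DirectSum.decomposeLinearEquiv 𝒱).symm.toLinearMap) := by
    refine MultilinearMap.directSum_ext (κ := fun _ => Fin n → ℤ) fun d => ?_
    ext v
    simp only [MultilinearMap.compLinearMap_apply, LinearEquiv.coe_coe]
    refine h d _ fun i => ?_
    rw [DirectSum.decomposeLinearEquiv_symm_apply, DirectSum.lof_eq_of,
      DirectSum.decompose_symm_of]
    exact (v i).2
  ext v
  simpa using congrArg (fun φ => φ fun i => DirectSum.decomposeLinearEquiv 𝒱 (v i)) key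

theorem tlift_word (g : (p : ℕ) → MultilinearMap K (fun _ : Fin (p + 1) => V) W) (p : ℕ)
    (v : Fin (p + 1) → V) : tlift g (word K V (p + 1) v) = g p v := by
  simp [tlift, word, DirectSum.toModule_lof]

theorem hom_ext_word {F G : T K V →ₗ[K] W}
    (h : ∀ p, F.compMultilinearMap (word K V (p + 1)) = G.compMultilinearMap (word K V (p + 1))) :
    F = G := by
  refine DirectSum.linearMap_ext K fun p => PiTensorProduct.ext ?_
  ext v
  exact congrArg (fun φ => φ v) (h p)

theorem hom_ext_homogeneous (𝒱 : (Fin n → ℤ) → Submodule K V)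
    [DirectSum.Decomposition 𝒱] {F G : T K V →ₗ[K] W}
    (h : ∀ (p : ℕ) (d : Fin (p + 1) → Fin n → ℤ) (v : Fin (p + 1) → V), (∀ i, v i ∈ 𝒱 (d i)) →
      F (word K V (p + 1) v) = G (word K V (p + 1) v)) :
    F = G :=
  hom_ext_word fun p => multilinear_ext_homogeneous 𝒱 fun d v hv => h p d v hv

variable (K) in
/-- The word `v₁ ⊗ ⋯ ⊗ v_m` of a list `[v₁, …, v_m]`. -/
noncomputable def listWord (l : List V) : T K V := word K V l.length l.get

/-- Passing to lists lets words of different lengths be concatenated and compared without casts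
between `Fin` types. -/
theorem word_eq_listWord {m : ℕ} (u : Fin m → V) : word K V m u = listWord K (List.ofFn u) := by
  -- The length is generalized so that `(List.ofFn u).length = m` can be eliminated by substitution.
  have : ∀ (m' : ℕ) (h : m' = m) (u' : Fin m' → V), (∀ t, u' t = u (Fin.cast h t)) →
      word K V m u = word K V m' u' := by
    rintro m' rfl u' h
    rw [funext h]
    rfl
  exact this _ (List.length_ofFn) _ fun t => by simp; rfl

@[simp] theorem listWord_nil : listWord K ([] : List V) = 0 := rfl

/-- The word of the subfamily `V_S`. -/
noncomputable def subWord {ι : Type*} [LinearOrder ι] (K : Type*) [Field K] {V : Type*}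
    [AddCommGroup V] [Module K V] (v : ι → V) (S : Finset ι) : T K V :=
  listWord K (S.sort.map v)

theorem ofFn_comp_orderEmbOfFin {ι α : Type*} [LinearOrder ι] (v : ι → α) (S : Finset ι) {m : ℕ}
    (h : S.card = m) : List.ofFn (fun t => v (S.orderEmbOfFin h t)) = S.sort.map v := by
  rw [← Finset.listMap_orderEmbOfFin_finRange S h, List.map_map, List.ofFn_eq_map]
  rfl

theorem ofFn_sub {α : Type*} {p : ℕ} (v : Fin p → α) (S : Finset (Fin p)) :
    List.ofFn (sub v S) = S.sort.map v :=
  ofFn_comp_orderEmbOfFin v S rfl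

theorem word_sub {p : ℕ} (v : Fin p → V) (S : Finset (Fin p)) :
    word K V S.card (sub v S) = subWord K v S := by
  rw [word_eq_listWord, ofFn_sub, subWord]

theorem subWord_univ {p : ℕ} (v : Fin p → V) : subWord K v Finset.univ = word K V p v := by
  rw [subWord, Fin.sort_univ, word_eq_listWord, List.ofFn_eq_map]

@[simp] theorem subWord_empty {ι : Type*} [LinearOrder ι] (v : ι → V) : subWord K v ∅ = 0 := by
  rw [subWord, Finset.sort_empty, List.map_nil, listWord_nil]

theorem subWord_map {ι κ : Type*} [LinearOrder ι] [LinearOrder κ] (f : κ ↪o ι) (v : ι → V)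
    (S : Finset κ) : subWord K v (S.map f.toEmbedding) = subWord K (fun i => v (f i)) S := by
  have h := (f.strictMono.strictMonoOn (s := (S : Set κ))).map_finsetSort (f := f.toEmbedding)
  rw [subWord, ← h, List.map_map]
  rfl

theorem sort_insert_max {ι : Type*} [LinearOrder ι] {S : Finset ι} {m : ι}
    (h : ∀ i ∈ S, i < m) : (insert m S).sort = S.sort ++ [m] := by
  refine List.Perm.eq_of_pairwise' (r := (· ≤ ·)) (Finset.pairwise_sort _ _) ?_ ?_
  · refine List.pairwise_append.2 ⟨Finset.pairwise_sort _ _, by simp, fun a ha b hb => ?_⟩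
    rw [List.mem_singleton.1 hb]
    exact (h a ((Finset.mem_sort _).1 ha)).le
  · refine (List.perm_ext_iff_of_nodup (Finset.sort_nodup _ _) ?_).2 fun a => by simp [or_comm]
    refine List.nodup_append.2 ⟨Finset.sort_nodup _ _, by simp, fun a ha b hb => ?_⟩
    rw [List.mem_singleton.1 hb]
    exact (h a ((Finset.mem_sort _).1 ha)).ne

variable (K V) in
/-- The inclusion `V → T(V)`. -/
noncomputable def incl : V →ₗ[K] T K V :=
  DirectSum.lof K ℕ (fun p => ⨂[K]^(p + 1) V) 0 ∘ₗ
    (PiTensorProduct.subsingletonEquiv (R := K) (s := fun _ : Fin 1 => V) 0).symm.toLinearMap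

theorem incl_apply (a : V) : incl K V a = listWord K [a] := by
  rw [show [a] = List.ofFn ![a] by simp, ← word_eq_listWord]
  simp only [incl, word, LinearMap.comp_apply, LinearEquiv.coe_coe,
    LinearMap.compMultilinearMap_apply]
  congr 1
  rw [LinearEquiv.symm_apply_eq, PiTensorProduct.subsingletonEquiv_apply_tprod]
  rfl

@[simp] theorem pr_incl (a : V) : pr (incl K V a) = a := by
  simp [pr, incl, DirectSum.component.lof_self]

theorem exists_ofFn_eq {α : Type*} {l : List α} {m : ℕ} (h : l.length = m) :
    ∃ u : Fin m → α, List.ofFn u = l := by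
  subst h
  exact ⟨l.get, List.ofFn_get l⟩

theorem pr_listWord {l : List V} (hl : 2 ≤ l.length) : pr (listWord K l) = 0 := by
  obtain ⟨m, hm⟩ := Nat.exists_eq_add_of_le' hl
  obtain ⟨u, rfl⟩ := exists_ofFn_eq hm
  rw [← word_eq_listWord]
  simp only [pr, word, LinearMap.comp_apply, LinearMap.compMultilinearMap_apply,
    DirectSum.component.of]
  simp

variable (K V) in
/-- The concatenation `T(V) × V → T(V)`, `(x, a) ↦ x ⊗ a`. -/
noncomputable def snocT : T K V →ₗ[K] V →ₗ[K] T K V :=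
  tlift fun p => (word K V (p + 2)).curryRight

theorem snocT_word (p : ℕ) (u : Fin (p + 1) → V) (a : V) :
    snocT K V (word K V (p + 1) u) a = word K V (p + 2) (Fin.snoc u a) := by
  rw [snocT, tlift_word]
  rfl

theorem snocT_listWord {l : List V} (hl : l ≠ []) (a : V) :
    snocT K V (listWord K l) a = listWord K (l ++ [a]) := by
  obtain ⟨m, hm⟩ : ∃ m, l.length = m + 1 := Nat.exists_eq_succ_of_ne_zero (by simpa using hl)
  obtain ⟨u, rfl⟩ := exists_ofFn_eq hm
  rw [← word_eq_listWord, snocT_word, word_eq_listWord, Fin.snoc_eq_append,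
    List.ofFn_fin_append]
  simp

theorem snocT_subWord {ι : Type*} [LinearOrder ι] (v : ι → V) {S : Finset ι} (hS : S.Nonempty)
    {m : ι} (h : ∀ i ∈ S, i < m) :
    snocT K V (subWord K v S) (v m) = subWord K v (insert m S) := by
  rw [subWord, snocT_listWord, subWord, sort_insert_max h, List.map_append, List.map_singleton]
  rw [Ne, List.map_eq_nil_iff, ← List.length_eq_zero_iff, Finset.length_sort]
  exact hS.card_pos.ne'

theorem subWord_singleton {ι : Type*} [LinearOrder ι] (v : ι → V) (m : ι) :
    subWord K v {m} = incl K V (v m) := by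
  rw [subWord, Finset.sort_singleton, incl_apply, List.map_singleton]

theorem pr_subWord_insert {ι : Type*} [LinearOrder ι] (v : ι → V) {S : Finset ι}
    (hS : S.Nonempty) {m : ι} (h : ∀ i ∈ S, i < m) : pr (subWord K v (insert m S)) = 0 := by
  refine pr_listWord ?_
  rw [List.length_map, sort_insert_max h, List.length_append, Finset.length_sort]
  have := hS.card_pos
  simp
  omega

/-! ### The coproduct on subwords. -/

theorem coproduct_word (𝒱 : (Fin n → ℤ) → Submodule K V) [DirectSum.Decomposition 𝒱] {p : ℕ}
    {d : Fin (p + 1) → Fin n → ℤ} {v : Fin (p + 1) → V} (hv : ∀ i, v i ∈ 𝒱 (d i)) :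
    coproduct 𝒱 (word K V (p + 1) v) =
      ∑ I ∈ Finset.univ.filter (fun I : Finset (Fin (p + 1)) => I.Nonempty ∧ Fin.last p ∉ I),
        (-1 : K) ^ crossing (fun i j => d i ⬝ᵥ d j) I Iᶜ •
          (subWord K v I ⊗ₜ[K] subWord K v Iᶜ) := by
  rw [coproduct, tlift_word, gradedLift_apply 𝒱 _ d v hv, sum_apply]
  refine Finset.sum_congr rfl fun I _ => ?_
  rw [smul_apply, splitWord_apply, word_sub, word_sub, koszulExponent_eq_invSum,
    invSum_pair _ disjoint_compl_right]

theorem exists_orderEmb_insert_max {ι : Type*} [LinearOrder ι] {S : Finset ι} {m : ι}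
    (h : ∀ i ∈ S, i < m) :
    ∃ f : Fin (S.card + 1) ↪o ι, Finset.univ.map f.toEmbedding = insert m S ∧
      f (Fin.last _) = m := by
  have hm : m ∉ S := fun hm => (h m hm).false
  refine ⟨(insert m S).orderEmbOfFin (Finset.card_insert_of_notMem hm),
    Finset.map_orderEmbOfFin_univ _ _, ?_⟩
  have := Finset.orderEmbOfFin_last (Finset.card_insert_of_notMem hm) (Nat.succ_pos _)
  refine Eq.trans this (le_antisymm (Finset.max'_le _ _ _ fun i hi => ?_)
    (Finset.le_max' _ _ (Finset.mem_insert_self _ _)))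
  rcases Finset.mem_insert.1 hi with rfl | hi
  exacts [le_rfl, (h i hi).le]

/-- The coproduct of a word indexed by a nonempty finite set with largest element `m`. -/
theorem coproduct_subWord (𝒱 : (Fin n → ℤ) → Submodule K V) [DirectSum.Decomposition 𝒱]
    {ι : Type*} [LinearOrder ι] {d : ι → Fin n → ℤ} {v : ι → V} (hv : ∀ i, v i ∈ 𝒱 (d i))
    {S : Finset ι} {m : ι} (h : ∀ i ∈ S, i < m) :
    coproduct 𝒱 (subWord K v (insert m S)) =
      ∑ I ∈ S.powerset.erase ∅, (-1 : K) ^ crossing (fun i j => d i ⬝ᵥ d j) I (S \ I) •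
          (subWord K v I ⊗ₜ[K] subWord K v (insert m (S \ I))) := by
  -- Increasing enumeration turns the subword into a full word whose last index is `m`; nonempty
  -- index sets avoiding the last position then correspond to nonempty subsets of `S`.
  obtain ⟨f, hf, hfm⟩ := exists_orderEmb_insert_max h
  have hm : m ∉ S := fun hm => (h m hm).false
  have hfS : ∀ x, f x ∈ S ↔ x ≠ Fin.last _ := fun x => by
    have hx : f x ∈ insert m S := hf ▸ Finset.mem_map_of_mem _ (Finset.mem_univ x)
    rw [Finset.mem_insert, ← hfm, f.injective.eq_iff] at hx
    refine ⟨fun hx' hl => hm (by rwa [hl, hfm] at hx'), fun hl => hx.resolve_left hl⟩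
  have hcompl : ∀ I : Finset (Fin (S.card + 1)), Fin.last _ ∉ I →
      Iᶜ.map f.toEmbedding = insert m (S \ I.map f.toEmbedding) := fun I hI => by
    rw [Finset.compl_eq_univ_sdiff, Finset.map_sdiff, hf, Finset.insert_sdiff_of_notMem]
    rintro hmI
    obtain ⟨x, hx, hxm⟩ := Finset.mem_map.1 hmI
    exact hI (f.injective (hfm.trans hxm.symm) ▸ hx)
  rw [← hf, subWord_map, subWord_univ, coproduct_word 𝒱 (d := fun i => d (f i)) fun i => hv (f i)]
  refine Finset.sum_bij (fun I _ => I.map f.toEmbedding) (fun I hI => ?_)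
    (fun I _ J _ hIJ => Finset.map_injective _ hIJ) (fun J hJ => ?_) (fun I hI => ?_)
  · obtain ⟨hI, hlast⟩ := (Finset.mem_filter.1 hI).2
    refine Finset.mem_erase.2 ⟨(hI.map).ne_empty, Finset.mem_powerset.2 fun i hi => ?_⟩
    obtain ⟨x, hx, rfl⟩ := Finset.mem_map.1 hi
    exact (hfS x).2 fun hxl => hlast (hxl ▸ hx)
  · obtain ⟨hJ, hJS⟩ := Finset.mem_erase.1 hJ
    rw [Finset.mem_powerset] at hJS
    obtain ⟨I, _, rfl⟩ := Finset.subset_map_iff.1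
      ((hJS.trans (Finset.subset_insert m S)).trans hf.symm.subset)
    refine ⟨I, Finset.mem_filter.2 ⟨Finset.mem_univ _, ?_, fun hlast => ?_⟩, rfl⟩
    · rw [Finset.nonempty_iff_ne_empty]
      rintro rfl
      exact hJ (Finset.map_empty _)
    · exact (hfS _).1 (hJS (Finset.mem_map_of_mem _ hlast)) rfl
  · obtain ⟨hI, hlast⟩ := (Finset.mem_filter.1 hI).2
    rw [← subWord_map, ← subWord_map, hcompl I hlast,
      ← crossing_map f (fun i j => d i ⬝ᵥ d j), hcompl I hlast,
      crossing_insert_of_lt]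
    · exact fun hm' => hm (Finset.mem_sdiff.1 hm').1
    · intro i hi
      obtain ⟨x, hx, rfl⟩ := Finset.mem_map.1 hi
      exact h _ ((hfS x).2 fun hxl => hlast (hxl ▸ hx))

theorem coproduct_incl (𝒱 : (Fin n → ℤ) → Submodule K V) [DirectSum.Decomposition 𝒱] :
    coproduct 𝒱 ∘ₗ incl K V = 0 := by
  ext a
  induction a using DirectSum.Decomposition.inductionOn 𝒱 with
  | zero => simp
  | add a b ha hb => rw [map_add, ha, hb, map_add]
  | @homogeneous i a =>
    have := coproduct_subWord 𝒱 (ι := Fin 1) (d := fun _ => i) (v := fun _ => (a : V))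
      (fun _ => a.2) (S := ∅) (m := 0) (by simp)
    rw [insert_empty_eq, subWord_singleton] at this
    simpa using this

end Words

/-! ### The recursive structure of the tensor coalgebra -/

section Recursion

variable {K : Type*} [Field K] {n : ℕ}
  {V : Type*} [AddCommGroup V] [Module K V]
  {V' : Type*} [AddCommGroup V'] [Module K V']
  {W : Type*} [AddCommMonoid W] [Module K W]

theorem exists_eq_insert_max {ι : Type*} [LinearOrder ι] {S : Finset ι} (hS : S.Nonempty) :
    ∃ m S', (∀ i ∈ S', i < m) ∧ S = insert m S' :=
  ⟨S.max' hS, S.erase (S.max' hS), fun _ hi => Finset.lt_max'_of_mem_erase_max' S hS hi,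
    (Finset.insert_erase (S.max'_mem hS)).symm⟩

/-- Linear maps on `T(V)` agree if they agree on every homogeneous word as soon as they agree on
all its subwords not containing the last letter. -/
theorem hom_ext_subWord (𝒱 : (Fin n → ℤ) → Submodule K V) [DirectSum.Decomposition 𝒱]
    {F G : T K V →ₗ[K] W}
    (h : ∀ (p : ℕ) (d : Fin p → Fin n → ℤ) (v : Fin p → V), (∀ i, v i ∈ 𝒱 (d i)) →
      ∀ (S : Finset (Fin p)) (m : Fin p), (∀ i ∈ S, i < m) →
        (∀ I ⊆ S, F (subWord K v I) = G (subWord K v I)) →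
          F (subWord K v (insert m S)) = G (subWord K v (insert m S))) : F = G := by
  refine hom_ext_homogeneous 𝒱 fun p d v hv => ?_
  have key : ∀ S : Finset (Fin (p + 1)), F (subWord K v S) = G (subWord K v S) := by
    intro S
    induction S using Finset.strongInduction with
    | H S ih =>
      rcases S.eq_empty_or_nonempty with rfl | hS
      · simp
      · obtain ⟨m, S', hm, rfl⟩ := exists_eq_insert_max hS
        refine h _ d v hv S' m hm fun I hI => ih I ?_
        exact hI.trans_ssubset (Finset.ssubset_insert fun hm' => (hm m hm').false)
  rw [← subWord_univ]
  exact key _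

variable (K V) in
/-- The concatenation `T(V) ⊗ V → T(V)`. -/
noncomputable def concat : T K V ⊗[K] V →ₗ[K] T K V := TensorProduct.lift (snocT K V)

@[simp] theorem concat_tmul (x : T K V) (a : V) : concat K V (x ⊗ₜ a) = snocT K V x a := rfl

theorem pr_snocT (x : T K V) (a : V) : pr (snocT K V x a) = 0 := by
  have : (snocT K V).compr₂ pr = 0 := hom_ext_word fun p => by
    ext u a
    simp only [LinearMap.compMultilinearMap_apply, LinearMap.compr₂_apply]
    rw [snocT_word, word_eq_listWord, pr_listWord (by simp)]
    rfl
  exact LinearMap.congr_fun₂ this x a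

/-- `pr` kills words of length at least 2, so only the splitting whose second factor is the single
letter `v m` survives. For `S = ∅` both sides vanish, since the empty word is zero. -/
theorem map_id_pr_coproduct_subWord (𝒱 : (Fin n → ℤ) → Submodule K V)
    [DirectSum.Decomposition 𝒱] {ι : Type*} [LinearOrder ι] {d : ι → Fin n → ℤ} {v : ι → V}
    (hv : ∀ i, v i ∈ 𝒱 (d i)) {S : Finset ι} {m : ι} (h : ∀ i ∈ S, i < m) :
    TensorProduct.map LinearMap.id pr (coproduct 𝒱 (subWord K v (insert m S))) =
      subWord K v S ⊗ₜ[K] v m := by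
  rw [coproduct_subWord 𝒱 hv h]
  rcases S.eq_empty_or_nonempty with rfl | hS
  · simp
  · rw [map_sum, Finset.sum_eq_single_of_mem S
        (Finset.mem_erase.2 ⟨hS.ne_empty, Finset.mem_powerset_self S⟩)]
    · simp [subWord_singleton]
    · intro I hI hIS
      have hI' := (Finset.mem_powerset.1 (Finset.mem_of_mem_erase hI)).ssubset_of_ne hIS
      rw [map_smul, TensorProduct.map_tmul, pr_subWord_insert v
        (Finset.sdiff_nonempty.2 hI'.2) fun i hi => h i (Finset.mem_sdiff.1 hi).1]
      simp

/-- An element of `T(V)` is the sum of its component in `V` and of the concatenation of the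
pieces obtained by splitting off the last letter. -/
theorem incl_pr_add_concat_coproduct (𝒱 : (Fin n → ℤ) → Submodule K V)
    [DirectSum.Decomposition 𝒱] (x : T K V) :
    incl K V (pr x) + concat K V (TensorProduct.map LinearMap.id pr (coproduct 𝒱 x)) = x := by
  have : incl K V ∘ₗ pr + concat K V ∘ₗ TensorProduct.map LinearMap.id pr ∘ₗ coproduct 𝒱 =
      LinearMap.id := by
    refine hom_ext_subWord 𝒱 fun p d v hv S m h _ => ?_
    simp only [LinearMap.add_apply, LinearMap.comp_apply, LinearMap.id_apply]
    rw [map_id_pr_coproduct_subWord 𝒱 hv h, concat_tmul]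
    rcases S.eq_empty_or_nonempty with rfl | hS
    · simp [subWord_singleton]
    · rw [pr_subWord_insert v hS h, map_zero, zero_add, snocT_subWord v hS h]
  exact LinearMap.congr_fun this x

/-- A linear map determined by its values on proper subwords vanishes. -/
theorem eq_zero_of_eq_concat (𝒱 : (Fin n → ℤ) → Submodule K V) [DirectSum.Decomposition 𝒱]
    (E : T K V →ₗ[K] T K V') (g : T K V →ₗ[K] V')
    (h : ∀ x, E x = concat K V' (TensorProduct.map E g (coproduct 𝒱 x))) : E = 0 := by
  refine hom_ext_subWord 𝒱 fun p d v hv S m hm ih => ?_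
  rw [h, coproduct_subWord 𝒱 hv hm, map_sum, map_sum, LinearMap.zero_apply]
  -- Only first factors supported on subsets of `S` enter, and `E` vanishes on these by induction.
  refine Finset.sum_eq_zero fun I hI => ?_
  rw [map_smul, TensorProduct.map_tmul,
    ih I (Finset.mem_powerset.1 (Finset.mem_of_mem_erase hI))]
  simp

theorem map_id_pr_map (F : T K V →ₗ[K] T K V') (G : T K V →ₗ[K] T K V') (z : T K V ⊗[K] T K V) :
    TensorProduct.map LinearMap.id pr (TensorProduct.map F G z) =
      TensorProduct.map F (pr ∘ₗ G) z := by
  rw [← LinearMap.comp_apply, ← TensorProduct.map_comp, LinearMap.id_comp]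

theorem map_sub_left_apply (F G : T K V →ₗ[K] T K V') (g : T K V →ₗ[K] V') (z : T K V ⊗[K] T K V) :
    TensorProduct.map (F - G) g z = TensorProduct.map F g z - TensorProduct.map G g z := by
  rw [eq_sub_iff_add_eq, ← LinearMap.add_apply, ← TensorProduct.map_add_left]
  congr 2
  exact sub_add_cancel F G

/-- A cohomomorphism is reconstructed from its corestriction. -/
theorem IsCohomomorphism.eq_incl_add_concat {𝒱 : (Fin n → ℤ) → Submodule K V}
    [DirectSum.Decomposition 𝒱] {𝒱' : (Fin n → ℤ) → Submodule K V'} [DirectSum.Decomposition 𝒱']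
    {F : T K V →ₗ[K] T K V'} (hF : IsCohomomorphism 𝒱 𝒱' F) (x : T K V) :
    F x = incl K V' (pr (F x)) +
      concat K V' (TensorProduct.map F (pr ∘ₗ F) (coproduct 𝒱 x)) := by
  have h := LinearMap.congr_fun hF.map_coproduct x
  simp only [LinearMap.comp_apply] at h
  conv_lhs => rw [← incl_pr_add_concat_coproduct 𝒱' (F x)]
  rw [h, map_id_pr_map]

/-- Subtracting the two reconstruction formulas cancels the one-letter parts and leaves `E = concat
∘ (E ⊗ pr F) ∘ Δ` for `E = F - G`. -/
theorem IsCohomomorphism.ext {𝒱 : (Fin n → ℤ) → Submodule K V}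
    [DirectSum.Decomposition 𝒱] {𝒱' : (Fin n → ℤ) → Submodule K V'} [DirectSum.Decomposition 𝒱']
    {F G : T K V →ₗ[K] T K V'} (hF : IsCohomomorphism 𝒱 𝒱' F) (hG : IsCohomomorphism 𝒱 𝒱' G)
    (h : pr ∘ₗ F = pr ∘ₗ G) : F = G := by
  refine sub_eq_zero.1 (eq_zero_of_eq_concat 𝒱 (F - G) (pr ∘ₗ F) fun x => ?_)
  have hx : pr (F x) = pr (G x) := LinearMap.congr_fun h x
  rw [LinearMap.sub_apply, hF.eq_incl_add_concat, hG.eq_incl_add_concat, hx, ← h,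
    add_sub_add_left_eq_sub, map_sub_left_apply, map_sub]

/-! ### Degrees, sign twists and the full coproduct -/

theorem word_mem_gradeT {𝒱 : (Fin n → ℤ) → Submodule K V} {p : ℕ} {d : Fin p → Fin n → ℤ}
    {v : Fin p → V} (hv : ∀ i, v i ∈ 𝒱 (d i)) : word K V p v ∈ gradeT 𝒱 (∑ i, d i) := by
  cases p with
  | zero => exact zero_mem _
  | succ p => exact Submodule.subset_span ⟨p, d, v, hv, rfl, rfl⟩

theorem exists_subWord_eq_word {ι : Type*} [LinearOrder ι] (v : ι → V) (S : Finset ι) :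
    ∃ f : Fin S.card ↪o ι, Finset.univ.map f.toEmbedding = S ∧
      subWord K v S = word K V S.card fun t => v (f t) :=
  ⟨S.orderEmbOfFin rfl, Finset.map_orderEmbOfFin_univ _ _, by
    rw [word_eq_listWord, ofFn_comp_orderEmbOfFin, subWord]⟩

theorem subWord_mem_gradeT {𝒱 : (Fin n → ℤ) → Submodule K V} {ι : Type*} [LinearOrder ι]
    {d : ι → Fin n → ℤ} {v : ι → V} (hv : ∀ i, v i ∈ 𝒱 (d i)) (S : Finset ι) :
    subWord K v S ∈ gradeT 𝒱 (∑ i ∈ S, d i) := by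
  obtain ⟨f, hf, hw⟩ := exists_subWord_eq_word (K := K) v S
  have : ∑ i ∈ S, d i = ∑ t, d (f t) := by
    conv_lhs => rw [← hf]
    simp
  rw [hw, this]
  exact word_mem_gradeT fun t => hv (f t)

theorem signTwist_apply (𝒱 : (Fin n → ℤ) → Submodule K V) [DirectSum.Decomposition 𝒱]
    (w : Fin n → ℤ) {α : Fin n → ℤ} {x : T K V} (hx : x ∈ gradeT 𝒱 α) :
    signTwist 𝒱 w x = (-1 : K) ^ (w ⬝ᵥ α) • x := by
  induction hx using Submodule.span_induction with
  | mem x hx =>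
    obtain ⟨p, d, v, hv, rfl, rfl⟩ := hx
    rw [signTwist, tlift_word, gradedLift_apply 𝒱 _ d v hv, smul_apply]
  | zero => simp
  | add x y _ _ hx hy => rw [map_add, hx, hy, smul_add]
  | smul c x _ hx => rw [map_smul, hx, smul_comm]

theorem signTwist_comm {𝒱 : (Fin n → ℤ) → Submodule K V} [DirectSum.Decomposition 𝒱]
    {𝒱' : (Fin n → ℤ) → Submodule K V'} [DirectSum.Decomposition 𝒱']
    {F : T K V →ₗ[K] T K V'} (hF : HasWeight 𝒱 𝒱' 0 F) (w : Fin n → ℤ) :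
    signTwist 𝒱' w ∘ₗ F = F ∘ₗ signTwist 𝒱 w := by
  refine hom_ext_homogeneous 𝒱 fun p d v hv => ?_
  have h := word_mem_gradeT (K := K) hv
  rw [LinearMap.comp_apply, LinearMap.comp_apply, signTwist_apply 𝒱 w h,
    signTwist_apply 𝒱' w (hF _ _ h), add_zero, map_smul]

/-- The signed exchange `x ⊗ y ↦ (-1)^{⟨x, y⟩} y ⊗ x`. -/
noncomputable def twist (𝒱 : (Fin n → ℤ) → Submodule K V) [DirectSum.Decomposition 𝒱] :
    T K V ⊗[K] T K V →ₗ[K] T K V ⊗[K] T K V :=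
  TensorProduct.lift <| tlift fun p => gradedLift 𝒱 fun d =>
    (LinearMap.lcomp K (T K V ⊗[K] T K V) (signTwist 𝒱 (∑ i, d i)) ∘ₗ
      (TensorProduct.mk K (T K V) (T K V)).flip).compMultilinearMap (word K V (p + 1))

theorem twist_tmul (𝒱 : (Fin n → ℤ) → Submodule K V) [DirectSum.Decomposition 𝒱]
    {α : Fin n → ℤ} {x : T K V} (hx : x ∈ gradeT 𝒱 α) (y : T K V) :
    twist 𝒱 (x ⊗ₜ y) = signTwist 𝒱 α y ⊗ₜ x := by
  induction hx using Submodule.span_induction with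
  | mem x hx =>
    obtain ⟨p, d, v, hv, rfl, rfl⟩ := hx
    rw [twist, TensorProduct.lift.tmul, tlift_word, gradedLift_apply 𝒱 _ d v hv]
    rfl
  | zero => simp
  | add x x' _ _ hx hx' => rw [TensorProduct.add_tmul, map_add, hx, hx', TensorProduct.tmul_add]
  | smul c x _ hx => rw [← TensorProduct.smul_tmul', map_smul, hx, TensorProduct.tmul_smul]

theorem twist_map {𝒱 : (Fin n → ℤ) → Submodule K V} [DirectSum.Decomposition 𝒱]
    {𝒱' : (Fin n → ℤ) → Submodule K V'} [DirectSum.Decomposition 𝒱']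
    {F : T K V →ₗ[K] T K V'} (hF : HasWeight 𝒱 𝒱' 0 F) :
    twist 𝒱' ∘ₗ TensorProduct.map F F = TensorProduct.map F F ∘ₗ twist 𝒱 := by
  refine TensorProduct.ext (hom_ext_homogeneous 𝒱 fun p d v hv => ?_)
  refine LinearMap.ext fun y => ?_
  have h := word_mem_gradeT (K := K) hv
  change twist 𝒱' (TensorProduct.map F F (word K V (p + 1) v ⊗ₜ y)) =
    TensorProduct.map F F (twist 𝒱 (word K V (p + 1) v ⊗ₜ y))
  rw [TensorProduct.map_tmul]
  rw [twist_tmul 𝒱 h, twist_tmul 𝒱' (hF _ _ h), TensorProduct.map_tmul, add_zero,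
    ← LinearMap.comp_apply, signTwist_comm hF, LinearMap.comp_apply]

/-- The symmetrized coproduct, the sum over all splittings into two nonempty subwords. -/
noncomputable def fullCoproduct (𝒱 : (Fin n → ℤ) → Submodule K V) [DirectSum.Decomposition 𝒱] :
    T K V →ₗ[K] T K V ⊗[K] T K V :=
  coproduct 𝒱 + twist 𝒱 ∘ₗ coproduct 𝒱

/-- `Δ` supplies the splittings with the last letter in the second factor and `τ Δ` those with it in
the first. The exchange sign converts the crossing of `(I; J)` into that of `(J; I)`. -/
theorem fullCoproduct_subWord (𝒱 : (Fin n → ℤ) → Submodule K V) [DirectSum.Decomposition 𝒱]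
    {ι : Type*} [LinearOrder ι] {d : ι → Fin n → ℤ} {v : ι → V} (hv : ∀ i, v i ∈ 𝒱 (d i))
    {S : Finset ι} (hS : S.Nonempty) :
    fullCoproduct 𝒱 (subWord K v S) =
      ∑ I ∈ (S.powerset.erase ∅).erase S, (-1 : K) ^ crossing (fun i j => d i ⬝ᵥ d j) I (S \ I) •
          (subWord K v I ⊗ₜ[K] subWord K v (S \ I)) := by
  obtain ⟨m, S, h, rfl⟩ := exists_eq_insert_max hS
  have hm : m ∉ S := fun hm => (h m hm).false
  rw [fullCoproduct, LinearMap.add_apply, LinearMap.comp_apply, coproduct_subWord 𝒱 hv h,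
    ← Finset.sum_filter_add_sum_filter_not (((insert m S).powerset.erase ∅).erase (insert m S))
      (fun I => m ∉ I), map_sum]
  have hIm : ∀ I ∈ S.powerset.erase ∅, m ∉ I := fun I hI hmI =>
    hm (Finset.mem_powerset.1 (Finset.mem_of_mem_erase hI) hmI)
  congr 1
  · refine Finset.sum_congr ?_ fun I hI => ?_
    · ext I
      simp only [Finset.mem_filter, Finset.mem_erase, Finset.mem_powerset]
      constructor
      · rintro ⟨h1, h2⟩
        have : m ∉ I := fun h' => hm (h2 h')
        exact ⟨⟨fun h' => this (h' ▸ Finset.mem_insert_self _ _), h1,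
          h2.trans (Finset.subset_insert _ _)⟩, this⟩
      · rintro ⟨⟨_, h1, h2⟩, h3⟩
        exact ⟨h1, (Finset.subset_insert_iff_of_notMem h3).1 h2⟩
    · have hI' := (Finset.mem_filter.1 hI).2
      have hIS := Finset.mem_powerset.1
        (Finset.mem_of_mem_erase (Finset.mem_of_mem_erase (Finset.mem_filter.1 hI).1))
      rw [Finset.insert_sdiff_of_notMem _ hI', crossing_insert_of_lt]
      · exact fun h' => hm (Finset.mem_sdiff.1 h').1
      · exact fun i hi => h i ((Finset.subset_insert_iff_of_notMem hI').1 hIS hi)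
  -- After the exchange, the first factor is the former second one, which contains `m`.
  · refine Finset.sum_bij (fun I _ => insert m (S \ I)) (fun I hI => ?_) (fun I hI J hJ hIJ => ?_)
      (fun J hJ => ?_) (fun I hI => ?_)
    · obtain ⟨h1, h2⟩ := Finset.mem_erase.1 hI
      rw [Finset.mem_powerset] at h2
      simp only [Finset.mem_filter, Finset.mem_erase, Finset.mem_powerset]
      refine ⟨⟨fun h' => h1 ?_, Finset.insert_ne_empty _ _,
        Finset.insert_subset_insert _ Finset.sdiff_subset⟩, by simp⟩
      rw [Finset.eq_empty_iff_forall_notMem]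
      intro x hx
      have := h'.symm ▸ Finset.mem_insert_of_mem (h2 hx)
      have hxm : x ≠ m := fun e => hm (e ▸ h2 hx)
      simp [hxm, hx] at this
    · have hI' := Finset.mem_powerset.1 (Finset.mem_of_mem_erase hI)
      have hJ' := Finset.mem_powerset.1 (Finset.mem_of_mem_erase hJ)
      have := congrArg (fun A => A.erase m) hIJ
      simp only [Finset.erase_insert (fun h' => hm (Finset.mem_sdiff.1 h').1)] at this
      rw [← Finset.sdiff_sdiff_eq_self hI', this, Finset.sdiff_sdiff_eq_self hJ']
    · simp only [Finset.mem_filter, Finset.mem_erase, Finset.mem_powerset, not_not] at hJ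
      obtain ⟨⟨h1, h2, h3⟩, h4⟩ := hJ
      have hJ : insert m (S \ (insert m S \ J)) = J := by
        ext x
        have := @h3 x
        by_cases hx : x = m
        · subst hx; simp [h4]
        · simp only [Finset.mem_insert, Finset.mem_sdiff, hx, false_or] at this ⊢
          tauto
      refine ⟨insert m S \ J, ?_, hJ⟩
      simp only [Finset.mem_erase, Finset.mem_powerset]
      refine ⟨fun h' => h1 (h3.antisymm (Finset.sdiff_eq_empty_iff_subset.1 h')), fun x hx => ?_⟩
      rw [Finset.mem_sdiff, Finset.mem_insert] at hx
      exact hx.1.resolve_left fun e => hx.2 (e ▸ h4)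
    · have hI' := Finset.mem_powerset.1 (Finset.mem_of_mem_erase hI)
      have hcompl : insert m S \ insert m (S \ I) = I := by
        ext x
        have := @hI' x
        by_cases hx : x = m
        · subst hx; simp [hIm I hI]
        · simp only [Finset.mem_insert, Finset.mem_sdiff, hx, false_or]
          tauto
      rw [hcompl, map_smul, twist_tmul 𝒱 (subWord_mem_gradeT hv I),
        signTwist_apply 𝒱 _ (subWord_mem_gradeT hv _), ← TensorProduct.smul_tmul', smul_smul,
        ← neg_one_zpow_add]
      congr 1
      have hd : Disjoint I (insert m (S \ I)) := by
        rw [Finset.disjoint_insert_right]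
        exact ⟨hIm I hI, Finset.disjoint_sdiff⟩
      have hsum := crossing_add_crossing (fun i j => d i ⬝ᵥ d j)
        (fun i j => dotProduct_comm _ _) hd
      rw [crossing_insert_of_lt _ (fun h' => hm (Finset.mem_sdiff.1 h').1)
        (fun i hi => h i (hI' hi))] at hsum
      have hdot : (∑ i ∈ I, d i) ⬝ᵥ (∑ j ∈ insert m (S \ I), d j) =
          ∑ i ∈ I, ∑ j ∈ insert m (S \ I), d i ⬝ᵥ d j := by
        simp_rw [sum_dotProduct, dotProduct_sum]
      rw [hdot, ← hsum]
      refine neg_one_zpow_congr ?_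
      push_cast
      rw [← add_assoc, CharTwo.add_self_eq_zero, zero_add]

end Recursion

/-! ### Cohomomorphisms with a prescribed corestriction -/

section Existence

variable {K : Type*} [Field K] {n : ℕ}
  {V : Type*} [AddCommGroup V] [Module K V]
  {V' : Type*} [AddCommGroup V'] [Module K V']

/-! ### The coproduct of a concatenation. -/

theorem coproduct_incl_apply (𝒱 : (Fin n → ℤ) → Submodule K V) [DirectSum.Decomposition 𝒱]
    (a : V) : coproduct 𝒱 (incl K V a) = 0 :=
  LinearMap.congr_fun (coproduct_incl 𝒱) a

/-- The last letter always belongs to the second factor. Either it stands there alone, or removing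
it leaves an arbitrary splitting of the rest into two nonempty subwords, which is why the
symmetrized coproduct appears. -/
theorem coproduct_snocT_subWord (𝒱 : (Fin n → ℤ) → Submodule K V) [DirectSum.Decomposition 𝒱]
    {ι : Type*} [LinearOrder ι] {d : ι → Fin n → ℤ} {v : ι → V} (hv : ∀ i, v i ∈ 𝒱 (d i))
    {S : Finset ι} (hS : S.Nonempty) {m : ι} (h : ∀ i ∈ S, i < m) :
    coproduct 𝒱 (snocT K V (subWord K v S) (v m)) =
      subWord K v S ⊗ₜ incl K V (v m) +
        TensorProduct.map LinearMap.id ((snocT K V).flip (v m))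
          (fullCoproduct 𝒱 (subWord K v S)) := by
  rw [snocT_subWord v hS h, coproduct_subWord 𝒱 hv h,
    ← Finset.add_sum_erase _ _ (Finset.mem_erase.2 ⟨hS.ne_empty, Finset.mem_powerset_self S⟩),
    fullCoproduct_subWord 𝒱 hv hS, map_sum]
  congr 1
  · simp [subWord_singleton]
  · refine Finset.sum_congr rfl fun I hI => ?_
    obtain ⟨hIS, hI⟩ := Finset.mem_erase.1 hI
    have hI' := (Finset.mem_powerset.1 (Finset.mem_of_mem_erase hI)).ssubset_of_ne hIS
    rw [map_smul, TensorProduct.map_tmul, LinearMap.flip_apply, snocT_subWord v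
      (Finset.sdiff_nonempty.2 hI'.2) fun i hi => h i (Finset.mem_sdiff.1 hi).1]
    rfl

theorem coproduct_snocT (𝒱 : (Fin n → ℤ) → Submodule K V) [DirectSum.Decomposition 𝒱]
    (x : T K V) (a : V) :
    coproduct 𝒱 (snocT K V x a) = x ⊗ₜ incl K V a +
      TensorProduct.map LinearMap.id ((snocT K V).flip a) (fullCoproduct 𝒱 x) := by
  induction a using DirectSum.Decomposition.inductionOn 𝒱 with
  | zero =>
    rw [map_zero, map_zero, map_zero, map_zero, TensorProduct.map_zero_right]
    simp
  | add a b ha hb =>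
    rw [map_add, map_add, ha, hb, map_add, TensorProduct.tmul_add, map_add,
      TensorProduct.map_add_right, LinearMap.add_apply]
    abel
  | @homogeneous α a =>
    have : coproduct 𝒱 ∘ₗ (snocT K V).flip a =
        (TensorProduct.mk K (T K V) (T K V)).flip (incl K V a) +
          TensorProduct.map LinearMap.id ((snocT K V).flip a) ∘ₗ fullCoproduct 𝒱 := by
      refine hom_ext_homogeneous 𝒱 fun p d v hv => ?_
      have key := coproduct_snocT_subWord (K := K) 𝒱 (d := Fin.snoc (α := fun _ => Fin n → ℤ) d α)
        (v := Fin.snoc (α := fun _ => V) v a)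
        (fun i => by
          refine Fin.lastCases ?_ (fun i => ?_) i
          · simp
          · simpa using hv i)
        (S := Finset.univ.map (Fin.castSuccOrderEmb (n := p + 1)).toEmbedding)
        (Finset.univ_nonempty.map) (m := Fin.last _) (fun i hi => by
          obtain ⟨j, _, rfl⟩ := Finset.mem_map.1 hi
          exact Fin.castSucc_lt_last j)
      rw [subWord_map] at key
      simp only [Fin.snoc_last, Fin.castSuccOrderEmb_apply, Fin.snoc_castSucc, subWord_univ] at key
      exact key
    exact LinearMap.congr_fun this x

/-- Approximations of the cohomomorphism with corestriction `φ`, correct on words of length at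
most `N`. -/
noncomputable def cohomApprox (𝒱 : (Fin n → ℤ) → Submodule K V) [DirectSum.Decomposition 𝒱]
    (φ : T K V →ₗ[K] V') : ℕ → T K V →ₗ[K] T K V'
  -- This is correct on words of length `0`, because the empty word is zero by convention.
  | 0 => 0
  | N + 1 => incl K V' ∘ₗ φ +
      concat K V' ∘ₗ TensorProduct.map (cohomApprox 𝒱 φ N) φ ∘ₗ coproduct 𝒱

/-- The recursion only evaluates the previous approximation on first factors of the coproduct. These
are shorter than the word, so the values stabilize once `N` reaches its length. -/
theorem cohomApprox_subWord_succ (𝒱 : (Fin n → ℤ) → Submodule K V) [DirectSum.Decomposition 𝒱]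
    (φ : T K V →ₗ[K] V') {ι : Type*} [LinearOrder ι] {d : ι → Fin n → ℤ} {v : ι → V}
    (hv : ∀ i, v i ∈ 𝒱 (d i)) (N : ℕ) (S : Finset ι) (hN : S.card ≤ N) :
    cohomApprox 𝒱 φ (N + 1) (subWord K v S) = cohomApprox 𝒱 φ N (subWord K v S) := by
  induction N generalizing S with
  | zero => simp [Finset.card_eq_zero.1 (Nat.le_zero.1 hN)]
  | succ N ih =>
    rcases S.eq_empty_or_nonempty with rfl | hS
    · simp
    · obtain ⟨m, S, h, rfl⟩ := exists_eq_insert_max hS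
      rw [Finset.card_insert_of_notMem fun hm => (h m hm).false, Nat.add_le_add_iff_right] at hN
      rw [cohomApprox, cohomApprox]
      simp only [LinearMap.add_apply, LinearMap.comp_apply]
      simp only [coproduct_subWord 𝒱 hv h, map_sum, map_smul, TensorProduct.map_tmul]
      congr 1
      refine Finset.sum_congr rfl fun I hI => ?_
      rw [← ih I ((Finset.card_le_card
        (Finset.mem_powerset.1 (Finset.mem_of_mem_erase hI))).trans hN), cohomApprox]

theorem cohomApprox_subWord (𝒱 : (Fin n → ℤ) → Submodule K V) [DirectSum.Decomposition 𝒱]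
    (φ : T K V →ₗ[K] V') {ι : Type*} [LinearOrder ι] {d : ι → Fin n → ℤ} {v : ι → V}
    (hv : ∀ i, v i ∈ 𝒱 (d i)) {N : ℕ} {S : Finset ι} (hN : S.card ≤ N) :
    cohomApprox 𝒱 φ N (subWord K v S) = cohomApprox 𝒱 φ S.card (subWord K v S) := by
  induction N, hN using Nat.le_induction with
  | base => rfl
  | succ N hN ih => rw [cohomApprox_subWord_succ 𝒱 φ hv N S hN, ih]

/-- The linear map `F` with corestriction `φ` determined by
`F = φ + concat ∘ (F ⊗ φ) ∘ Δ`. -/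
noncomputable def cohomLift (𝒱 : (Fin n → ℤ) → Submodule K V) [DirectSum.Decomposition 𝒱]
    (φ : T K V →ₗ[K] V') : T K V →ₗ[K] T K V' :=
  tlift fun p => (cohomApprox 𝒱 φ (p + 1)).compMultilinearMap (word K V (p + 1))

theorem cohomLift_subWord (𝒱 : (Fin n → ℤ) → Submodule K V) [DirectSum.Decomposition 𝒱]
    (φ : T K V →ₗ[K] V') {ι : Type*} [LinearOrder ι] (v : ι → V) (S : Finset ι) :
    cohomLift 𝒱 φ (subWord K v S) = cohomApprox 𝒱 φ S.card (subWord K v S) := by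
  rcases S.eq_empty_or_nonempty with rfl | hS
  · simp
  · obtain ⟨f, -, hw⟩ := exists_subWord_eq_word (K := K) v S
    obtain ⟨m, hm⟩ := Nat.exists_eq_succ_of_ne_zero hS.card_pos.ne'
    rw [hw]
    clear hw
    revert f
    rw [hm]
    intro f
    rw [cohomLift, tlift_word]
    rfl

/-- By stabilization, the different approximations used for words of different lengths may all be
replaced by the same map in the recursion. -/
theorem cohomLift_eq (𝒱 : (Fin n → ℤ) → Submodule K V) [DirectSum.Decomposition 𝒱]
    (φ : T K V →ₗ[K] V') (x : T K V) :
    cohomLift 𝒱 φ x = incl K V' (φ x) +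
      concat K V' (TensorProduct.map (cohomLift 𝒱 φ) φ (coproduct 𝒱 x)) := by
  have : cohomLift 𝒱 φ = incl K V' ∘ₗ φ +
      concat K V' ∘ₗ TensorProduct.map (cohomLift 𝒱 φ) φ ∘ₗ coproduct 𝒱 := by
    refine hom_ext_subWord 𝒱 fun p d v hv S m h _ => ?_
    rw [cohomLift_subWord, Finset.card_insert_of_notMem fun hm => (h m hm).false, cohomApprox]
    simp only [LinearMap.add_apply, LinearMap.comp_apply]
    simp only [coproduct_subWord 𝒱 hv h, map_sum, map_smul, TensorProduct.map_tmul]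
    congr 1
    refine Finset.sum_congr rfl fun I hI => ?_
    rw [cohomLift_subWord, cohomApprox_subWord 𝒱 φ hv]
    exact Finset.card_le_card (Finset.mem_powerset.1 (Finset.mem_of_mem_erase hI))
  exact LinearMap.congr_fun this x

/-- Concatenations have no one-letter component, so only the term `incl ∘ φ` is seen by `pr`. -/
theorem pr_cohomLift (𝒱 : (Fin n → ℤ) → Submodule K V) [DirectSum.Decomposition 𝒱]
    (φ : T K V →ₗ[K] V') : pr ∘ₗ cohomLift 𝒱 φ = φ := by
  have h : pr ∘ₗ concat K V' = 0 := TensorProduct.ext' fun x a => pr_snocT x a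
  refine LinearMap.ext fun x => ?_
  rw [LinearMap.comp_apply, cohomLift_eq, map_add, pr_incl, ← LinearMap.comp_apply (f := pr), h]
  simp

/-! ### Degrees of concatenations and of the lift. -/

theorem incl_mem_gradeT {𝒱 : (Fin n → ℤ) → Submodule K V} {α : Fin n → ℤ} {a : V}
    (ha : a ∈ 𝒱 α) : incl K V a ∈ gradeT 𝒱 α := by
  have := subWord_mem_gradeT (K := K) (𝒱 := 𝒱) (d := fun _ : Fin 1 => α) (v := fun _ => a)
    (fun _ => ha) {0}
  rwa [subWord_singleton, Finset.sum_singleton] at this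

theorem snocT_mem_gradeT {𝒱 : (Fin n → ℤ) → Submodule K V} {α β : Fin n → ℤ} {x : T K V} {a : V}
    (hx : x ∈ gradeT 𝒱 α) (ha : a ∈ 𝒱 β) : snocT K V x a ∈ gradeT 𝒱 (α + β) := by
  induction hx using Submodule.span_induction with
  | mem x hx =>
    obtain ⟨p, d, v, hv, rfl, rfl⟩ := hx
    rw [snocT_word]
    have := word_mem_gradeT (K := K) (𝒱 := 𝒱) (d := Fin.snoc (α := fun _ => Fin n → ℤ) d β)
      (v := Fin.snoc (α := fun _ => V) v a) (fun i => by
        refine Fin.lastCases ?_ (fun i => ?_) i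
        · simpa using ha
        · simpa using hv i)
    rwa [Fin.sum_snoc] at this
  | zero => simp
  | add x y _ _ hx hy => rw [map_add]; exact add_mem hx hy
  | smul c x _ hx => rw [map_smul]; exact Submodule.smul_mem _ c hx

theorem hasWeight_of_subWord {𝒱 : (Fin n → ℤ) → Submodule K V}
    {𝒱' : (Fin n → ℤ) → Submodule K V'} {w : Fin n → ℤ} {G : T K V →ₗ[K] T K V'}
    (h : ∀ (p : ℕ) (d : Fin p → Fin n → ℤ) (v : Fin p → V), (∀ i, v i ∈ 𝒱 (d i)) →
      ∀ S : Finset (Fin p), G (subWord K v S) ∈ gradeT 𝒱' (∑ i ∈ S, d i + w)) :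
    HasWeight 𝒱 𝒱' w G := by
  intro α x hx
  induction hx using Submodule.span_induction with
  | mem x hx =>
    obtain ⟨p, d, v, hv, rfl, rfl⟩ := hx
    rw [← subWord_univ]
    exact h _ d v hv _
  | zero => simp
  | add x y _ _ hx hy => rw [map_add]; exact add_mem hx hy
  | smul c x _ hx => rw [map_smul]; exact Submodule.smul_mem _ c hx

theorem cohomLift_hasWeight {𝒱 : (Fin n → ℤ) → Submodule K V} [DirectSum.Decomposition 𝒱]
    {𝒱' : (Fin n → ℤ) → Submodule K V'} {φ : T K V →ₗ[K] V'}
    (hφ : ∀ α, ∀ x ∈ gradeT 𝒱 α, φ x ∈ 𝒱' α) : HasWeight 𝒱 𝒱' 0 (cohomLift 𝒱 φ) := by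
  refine hasWeight_of_subWord fun p d v hv S => ?_
  rw [add_zero]
  induction S using Finset.strongInduction with
  | H S ih =>
    rcases S.eq_empty_or_nonempty with rfl | hS
    · simp
    · obtain ⟨m, S, h, rfl⟩ := exists_eq_insert_max hS
      have hm : m ∉ S := fun hm => (h m hm).false
      rw [cohomLift_eq, coproduct_subWord 𝒱 hv h, map_sum, map_sum]
      refine add_mem (incl_mem_gradeT (hφ _ _ (subWord_mem_gradeT hv _)))
        (sum_mem fun I hI => ?_)
      have hIS := Finset.mem_powerset.1 (Finset.mem_of_mem_erase hI)
      rw [map_smul, map_smul, TensorProduct.map_tmul, concat_tmul]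
      have hsum : ∑ i ∈ insert m S, d i = ∑ i ∈ I, d i + ∑ i ∈ insert m (S \ I), d i := by
        rw [Finset.sum_insert hm, Finset.sum_insert fun h' => hm (Finset.mem_sdiff.1 h').1,
          ← Finset.sum_sdiff hIS]
        abel
      rw [hsum]
      exact Submodule.smul_mem _ _ (snocT_mem_gradeT
        (ih I (hIS.trans_ssubset (Finset.ssubset_insert hm))) (hφ _ _ (subWord_mem_gradeT hv _)))

/-- Iterated splittings into three subwords, taken in the two possible orders. -/
theorem sum_split_assoc {ι M : Type*} [LinearOrder ι] [AddCommMonoid M] (S : Finset ι)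
    (f : Finset ι → Finset ι → Finset ι → M) :
    ∑ I ∈ S.powerset.erase ∅, ∑ A ∈ (I.powerset.erase ∅).erase I, f A (I \ A) (S \ I) =
      ∑ A ∈ S.powerset.erase ∅, ∑ B ∈ (S \ A).powerset.erase ∅, f A B ((S \ A) \ B) := by
  rw [Finset.sum_sigma', Finset.sum_sigma']
  -- An ordered triple `(A, B, C)` is encoded on the left by `(A ∪ B, A)` and on the right by `(A,
  -- B)`.
  refine Finset.sum_bij' (fun x _ => ⟨x.2, x.1 \ x.2⟩) (fun x _ => ⟨x.1 ∪ x.2, x.1⟩) ?_ ?_ ?_ ?_ ?_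
  · rintro ⟨I, A⟩ h
    simp only [Finset.mem_sigma, Finset.mem_erase, Finset.mem_powerset,
      ← Finset.nonempty_iff_ne_empty] at h ⊢
    obtain ⟨⟨hI, hIS⟩, hAI, hA, hAI'⟩ := h
    exact ⟨⟨hA, hAI'.trans hIS⟩, Finset.sdiff_nonempty.2 (hAI'.ssubset_of_ne hAI).2,
      Finset.sdiff_subset_sdiff hIS le_rfl⟩
  · rintro ⟨A, B⟩ h
    simp only [Finset.mem_sigma, Finset.mem_erase, Finset.mem_powerset,
      ← Finset.nonempty_iff_ne_empty] at h ⊢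
    obtain ⟨⟨hA, hAS⟩, hB, hBS⟩ := h
    refine ⟨⟨hA.mono Finset.subset_union_left,
      Finset.union_subset hAS (hBS.trans Finset.sdiff_subset)⟩, fun he => ?_, hA,
      Finset.subset_union_left⟩
    obtain ⟨b, hb⟩ := hB
    exact (Finset.mem_sdiff.1 (hBS hb)).2 (he.symm.subset (Finset.mem_union_right _ hb))
  · rintro ⟨I, A⟩ h
    simp only [Finset.mem_sigma, Finset.mem_erase, Finset.mem_powerset] at h
    simp [Finset.union_eq_right.2 h.2.2.2]
  · rintro ⟨A, B⟩ h
    simp only [Finset.mem_sigma, Finset.mem_erase, Finset.mem_powerset] at h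
    have : Disjoint B A := (Finset.subset_sdiff.1 h.2.2).2
    simp [Finset.union_sdiff_cancel_left this.symm]
  · rintro ⟨I, A⟩ h
    simp only [Finset.mem_sigma, Finset.mem_erase, Finset.mem_powerset] at h
    congr 1
    rw [sdiff_sdiff_left, Finset.sup_eq_union, Finset.union_sdiff_of_subset h.2.2.2]

/-- The linear map `cohomLift 𝒱 φ` is a cohomomorphism. -/
theorem isCohomomorphism_cohomLift {𝒱 : (Fin n → ℤ) → Submodule K V} [DirectSum.Decomposition 𝒱]
    {𝒱' : (Fin n → ℤ) → Submodule K V'} [DirectSum.Decomposition 𝒱'] {φ : T K V →ₗ[K] V'}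
    (hφ : ∀ α, ∀ x ∈ gradeT 𝒱 α, φ x ∈ 𝒱' α) : IsCohomomorphism 𝒱 𝒱' (cohomLift 𝒱 φ) := by
  have hw := cohomLift_hasWeight hφ
  refine ⟨hw, hom_ext_subWord 𝒱 fun p d v hv S m h ih => ?_⟩
  have hm : m ∉ S := fun hm => (h m hm).false
  set F := cohomLift 𝒱 φ with hF
  set β : Fin p → Fin p → ℤ := fun i j => d i ⬝ᵥ d j with hβ
  -- The induction hypothesis gives compatibility with `Δ` on subwords of `S`. It extends to the
  -- symmetrized coproduct because a weight `0` map commutes with the signed exchange.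
  have hfull : ∀ I ⊆ S, I.Nonempty → fullCoproduct 𝒱' (F (subWord K v I)) =
      ∑ A ∈ (I.powerset.erase ∅).erase I, (-1 : K) ^ crossing β A (I \ A) •
          (F (subWord K v A) ⊗ₜ[K] F (subWord K v (I \ A))) := by
    intro I hI hI'
    have h1 := ih I hI
    rw [LinearMap.comp_apply, LinearMap.comp_apply] at h1
    rw [fullCoproduct, LinearMap.add_apply, LinearMap.comp_apply, h1,
      ← LinearMap.comp_apply (f := twist 𝒱'), twist_map hw, LinearMap.comp_apply, ← map_add]
    have h2 := fullCoproduct_subWord (K := K) 𝒱 hv hI'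
    rw [fullCoproduct, LinearMap.add_apply, LinearMap.comp_apply] at h2
    rw [h2, map_sum]
    exact Finset.sum_congr rfl fun A _ => by rw [map_smul, TensorProduct.map_tmul]
  rw [LinearMap.comp_apply, LinearMap.comp_apply, hF, cohomLift_eq, ← hF,
    coproduct_subWord 𝒱 hv h, map_add, coproduct_incl_apply, zero_add]
  simp only [map_sum, map_smul, TensorProduct.map_tmul, concat_tmul, coproduct_snocT]
  -- In `Δ F`, the coproduct of each concatenation `F(V_I) ⊗ φ(…)` gives a two-part term and
  -- splittings `I = A ⊔ (I \ A)`.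
  have hL : ∀ I ∈ S.powerset.erase ∅,
      (-1 : K) ^ crossing β I (S \ I) • (F (subWord K v I) ⊗ₜ[K]
        incl K V' (φ (subWord K v (insert m (S \ I)))) +
        TensorProduct.map LinearMap.id ((snocT K V').flip (φ (subWord K v (insert m (S \ I)))))
          (fullCoproduct 𝒱' (F (subWord K v I)))) =
      (-1 : K) ^ crossing β I (S \ I) • (F (subWord K v I) ⊗ₜ[K]
        incl K V' (φ (subWord K v (insert m (S \ I))))) +
      ∑ A ∈ (I.powerset.erase ∅).erase I,
        (-1 : K) ^ (crossing β A (I \ A) + crossing β A (S \ I) + crossing β (I \ A) (S \ I)) •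
          (F (subWord K v A) ⊗ₜ[K]
            snocT K V' (F (subWord K v (I \ A))) (φ (subWord K v (insert m (S \ I))))) := by
    intro I hI
    obtain ⟨hI, hIS⟩ := Finset.mem_erase.1 hI
    rw [hfull I (Finset.mem_powerset.1 hIS) (Finset.nonempty_iff_ne_empty.2 hI), smul_add]
    congr 1
    simp only [map_sum, map_smul, TensorProduct.map_tmul, Finset.smul_sum]
    refine Finset.sum_congr rfl fun A hA => ?_
    have hAI := Finset.mem_powerset.1 (Finset.mem_of_mem_erase (Finset.mem_of_mem_erase hA))
    rw [smul_smul, ← neg_one_zpow_add, add_assoc, ← crossing_union_left β Finset.disjoint_sdiff,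
      Finset.union_sdiff_of_subset hAI, add_comm]
    rfl
  -- In `(F ⊗ F) Δ`, the second factor is expanded by the recursion for `F`, again giving a two-part
  -- term and three-part terms.
  have hR : ∀ A ∈ S.powerset.erase ∅,
      (-1 : K) ^ crossing β A (S \ A) • (F (subWord K v A) ⊗ₜ[K]
        F (subWord K v (insert m (S \ A)))) =
      (-1 : K) ^ crossing β A (S \ A) • (F (subWord K v A) ⊗ₜ[K]
        incl K V' (φ (subWord K v (insert m (S \ A))))) +
      ∑ B ∈ (S \ A).powerset.erase ∅,
        (-1 : K) ^ (crossing β A B + crossing β A ((S \ A) \ B) + crossing β B ((S \ A) \ B)) •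
          (F (subWord K v A) ⊗ₜ[K]
            snocT K V' (F (subWord K v B)) (φ (subWord K v (insert m ((S \ A) \ B))))) := by
    intro A hA
    conv_lhs => rw [hF, cohomLift_eq 𝒱 φ (subWord K v (insert m (S \ A))), ← hF]
    rw [coproduct_subWord 𝒱 hv fun i hi => h i (Finset.mem_sdiff.1 hi).1,
      TensorProduct.tmul_add, smul_add]
    congr 1
    simp only [map_sum, map_smul, TensorProduct.map_tmul, concat_tmul, TensorProduct.tmul_sum,
      TensorProduct.tmul_smul, Finset.smul_sum]
    refine Finset.sum_congr rfl fun B hB => ?_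
    have hBS := Finset.mem_powerset.1 (Finset.mem_of_mem_erase hB)
    rw [smul_smul, ← neg_one_zpow_add, ← crossing_union_right β A Finset.disjoint_sdiff,
      Finset.union_sdiff_of_subset hBS]
  rw [Finset.sum_congr rfl hL, Finset.sum_congr rfl hR, Finset.sum_add_distrib,
    Finset.sum_add_distrib]
  congr 1
  -- The three-part terms depend only on `(A, B, C)`, with the sign of all pairwise crossings, so
  -- the two orders of splitting give the same sum.
  exact sum_split_assoc S fun A B C =>
    (-1 : K) ^ (crossing β A B + crossing β A C + crossing β B C) •
      (F (subWord K v A) ⊗ₜ[K] snocT K V' (F (subWord K v B)) (φ (subWord K v (insert m C))))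

end Existence

/-! ### Coderivations and explicit formulas -/

section Coderivations

variable {K : Type*} [Field K] {n : ℕ}
  {V : Type*} [AddCommGroup V] [Module K V]
  {V' : Type*} [AddCommGroup V'] [Module K V']

/-- A cohomomorphism intertwines two coderivations if the corestrictions agree. -/
theorem IsCohomomorphism.intertwines {𝒱 : (Fin n → ℤ) → Submodule K V}
    [DirectSum.Decomposition 𝒱] {𝒱' : (Fin n → ℤ) → Submodule K V'} [DirectSum.Decomposition 𝒱']
    {w : Fin n → ℤ} {Q : T K V →ₗ[K] T K V} {Q' : T K V' →ₗ[K] T K V'} {F : T K V →ₗ[K] T K V'}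
    (hQ : IsCoderivation 𝒱 w Q) (hQ' : IsCoderivation 𝒱' w Q') (hF : IsCohomomorphism 𝒱 𝒱' F)
    (h : pr ∘ₗ Q' ∘ₗ F = pr ∘ₗ F ∘ₗ Q) : Q' ∘ₗ F = F ∘ₗ Q := by
  -- Both `Q' F` and `F Q` satisfy a Leibniz rule along `F`, with the same sign twist since `F`
  -- preserves degrees.
  have h1 : coproduct 𝒱' ∘ₗ Q' ∘ₗ F = (TensorProduct.map (Q' ∘ₗ F) F +
      TensorProduct.map (F ∘ₗ signTwist 𝒱 w) (Q' ∘ₗ F)) ∘ₗ coproduct 𝒱 := by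
    rw [← LinearMap.comp_assoc, hQ'.coLeibniz, LinearMap.comp_assoc, hF.map_coproduct,
      ← LinearMap.comp_assoc, LinearMap.add_comp, ← TensorProduct.map_comp,
      ← TensorProduct.map_comp, signTwist_comm hF.hasWeight, LinearMap.id_comp]
  have h2 : coproduct 𝒱' ∘ₗ F ∘ₗ Q = (TensorProduct.map (F ∘ₗ Q) F +
      TensorProduct.map (F ∘ₗ signTwist 𝒱 w) (F ∘ₗ Q)) ∘ₗ coproduct 𝒱 := by
    rw [← LinearMap.comp_assoc, hF.map_coproduct, LinearMap.comp_assoc, hQ.coLeibniz,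
      ← LinearMap.comp_assoc, LinearMap.comp_add, ← TensorProduct.map_comp,
      ← TensorProduct.map_comp, LinearMap.comp_id]
  refine sub_eq_zero.1 (eq_zero_of_eq_concat 𝒱 (Q' ∘ₗ F - F ∘ₗ Q) (pr ∘ₗ F) fun x => ?_)
  have hx : pr ((Q' ∘ₗ F) x) = pr ((F ∘ₗ Q) x) := LinearMap.congr_fun h x
  have h1x := LinearMap.congr_fun h1 x
  have h2x := LinearMap.congr_fun h2 x
  rw [LinearMap.comp_apply] at h1x h2x
  rw [LinearMap.sub_apply, ← incl_pr_add_concat_coproduct 𝒱' ((Q' ∘ₗ F) x),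
    ← incl_pr_add_concat_coproduct 𝒱' ((F ∘ₗ Q) x), h1x, h2x, hx, add_sub_add_left_eq_sub]
  simp only [LinearMap.comp_apply, LinearMap.add_apply, map_add, map_id_pr_map]
  -- Equal corestrictions make the second Leibniz terms cancel; the first ones leave the recursion
  -- that forces the difference to vanish.
  rw [h, add_sub_add_right_eq_sub, map_sub_left_apply, map_sub]

/-- Either the corestriction of `Q` absorbs the last letter (the sum over the letters `I` left in
front), or the last letter stays in place and `Q` acts before it. The term `I = ∅` is the one-letter
component of the value, the others come from `id ⊗ Q`. -/
theorem IsCoderivation.apply_subWord_insert {𝒱 : (Fin n → ℤ) → Submodule K V}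
    [DirectSum.Decomposition 𝒱] {w : Fin n → ℤ} {Q : T K V →ₗ[K] T K V}
    (hQ : IsCoderivation 𝒱 w Q) {ι : Type*} [LinearOrder ι] {d : ι → Fin n → ℤ} {v : ι → V}
    (hv : ∀ i, v i ∈ 𝒱 (d i)) {S : Finset ι} {m : ι} (h : ∀ i ∈ S, i < m) :
    Q (subWord K v (insert m S)) =
      ∑ I ∈ S.powerset,
        (-1 : K) ^ (w ⬝ᵥ ∑ i ∈ I, d i + crossing (fun i j => d i ⬝ᵥ d j) I (S \ I)) •
          listWord K (I.sort.map v ++ [pr (Q (subWord K v (insert m (S \ I))))]) +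
      snocT K V (Q (subWord K v S)) (v m) := by
  have hx := LinearMap.congr_fun hQ.coLeibniz (subWord K v (insert m S))
  rw [LinearMap.comp_apply, LinearMap.comp_apply, LinearMap.add_apply] at hx
  rw [← incl_pr_add_concat_coproduct 𝒱 (Q (subWord K v (insert m S))), hx, map_add,
    map_id_pr_map, map_id_pr_map, LinearMap.comp_id]
  have h1 : TensorProduct.map Q pr (coproduct 𝒱 (subWord K v (insert m S))) =
      Q (subWord K v S) ⊗ₜ v m := by
    rw [show TensorProduct.map Q pr = TensorProduct.map Q LinearMap.id ∘ₗ
        TensorProduct.map LinearMap.id pr by rw [← TensorProduct.map_comp]; simp,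
      LinearMap.comp_apply, map_id_pr_coproduct_subWord 𝒱 hv h, TensorProduct.map_tmul]
    rfl
  rw [h1, coproduct_subWord 𝒱 hv h, map_add, concat_tmul,
    ← Finset.add_sum_erase _ _ (Finset.empty_mem_powerset S), add_comm (snocT _ _ _ _), ← add_assoc]
  congr 2
  · simp [incl_apply]
  · simp only [map_sum, map_smul, TensorProduct.map_tmul, concat_tmul]
    refine Finset.sum_congr rfl fun I hI => ?_
    rw [signTwist_apply 𝒱 w (subWord_mem_gradeT hv I), map_smul, LinearMap.smul_apply, smul_smul,
      ← neg_one_zpow_add, add_comm, subWord, snocT_listWord]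
    · rfl
    · rw [Ne, List.map_eq_nil_iff, ← List.length_eq_zero_iff, Finset.length_sort,
        Finset.card_eq_zero]
      exact (Finset.mem_erase.1 hI).1

/-- The values of a coderivation in terms of its corestriction. -/
theorem IsCoderivation.apply_subWord {𝒱 : (Fin n → ℤ) → Submodule K V}
    [DirectSum.Decomposition 𝒱] {w : Fin n → ℤ} {Q : T K V →ₗ[K] T K V}
    (hQ : IsCoderivation 𝒱 w Q) {ι : Type*} [LinearOrder ι] {d : ι → Fin n → ℤ} {v : ι → V}
    (hv : ∀ i, v i ∈ 𝒱 (d i)) (S : Finset ι) :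
    Q (subWord K v S) = ∑ k ∈ S, ∑ I ∈ (S.filter (· < k)).powerset,
      (-1 : K) ^ (w ⬝ᵥ ∑ i ∈ I, d i +
        crossing (fun i j => d i ⬝ᵥ d j) I (S.filter (· < k) \ I)) •
          listWord K (I.sort.map v ++ [pr (Q (subWord K v (insert k (S.filter (· < k) \ I))))] ++
            (S.filter (k < ·)).sort.map v) := by
  induction S using Finset.induction_on_max with
  | empty => simp
  | insert m S h ih =>
    have hm : m ∉ S := fun hm => (h m hm).false
    rw [hQ.apply_subWord_insert hv h, Finset.sum_insert hm]
    congr 1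
    · have h1 : (insert m S).filter (· < m) = S := by
        ext i
        simp only [Finset.mem_filter, Finset.mem_insert]
        exact ⟨fun hi => hi.1.resolve_left hi.2.ne, fun hi => ⟨Or.inr hi, h i hi⟩⟩
      have h2 : (insert m S).filter (m < ·) = ∅ := by
        refine Finset.filter_false_of_mem fun i hi => ?_
        rcases Finset.mem_insert.1 hi with rfl | hi
        exacts [lt_irrefl _, (h i hi).not_gt]
      rw [h1, h2]
      simp
    · rw [ih, map_sum, LinearMap.sum_apply]
      refine Finset.sum_congr rfl fun k hk => ?_
      have h1 : (insert m S).filter (· < k) = S.filter (· < k) := by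
        rw [Finset.filter_insert, if_neg (h k hk).not_gt]
      have h2 : (insert m S).filter (k < ·) = insert m (S.filter (k < ·)) := by
        rw [Finset.filter_insert, if_pos (h k hk)]
      rw [h1, h2, sort_insert_max fun i hi => h i (Finset.mem_filter.1 hi).1, map_sum,
        LinearMap.sum_apply]
      refine Finset.sum_congr rfl fun I _ => ?_
      rw [map_smul, LinearMap.smul_apply, snocT_listWord (by simp)]
      simp

/-- The tuples of `blocks`, for the subset `S` of `{1, …, p}` in place of `{1, …, p}`. -/
def blocksOf {p : ℕ} (S : Finset (Fin p)) (s : ℕ) : Finset (Fin s → Finset (Fin p)) :=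
  Finset.univ.filter fun I =>
    (∀ r, (I r).Nonempty) ∧ (∀ r r', r ≠ r' → Disjoint (I r) (I r')) ∧
    (∀ i, i ∈ S ↔ ∃ r, i ∈ I r) ∧ (∀ r r', r < r' → (I r).max < (I r').max)

/-! ### Decompositions into blocks with increasing last elements. -/

theorem blocks_eq_blocksOf (p s : ℕ) : blocks p s = blocksOf Finset.univ s := by
  simp [blocks, blocksOf]

theorem mem_blocksOf {p s : ℕ} {S : Finset (Fin p)} {B : Fin s → Finset (Fin p)} :
    B ∈ blocksOf S s ↔ (∀ r, (B r).Nonempty) ∧ (∀ r r', r ≠ r' → Disjoint (B r) (B r')) ∧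
      (∀ i, i ∈ S ↔ ∃ r, i ∈ B r) ∧ (∀ r r', r < r' → (B r).max < (B r').max) := by
  simp [blocksOf]

theorem blocksOf_empty_succ {p : ℕ} (s : ℕ) : blocksOf (∅ : Finset (Fin p)) (s + 1) = ∅ := by
  refine Finset.eq_empty_of_forall_notMem fun B hB => ?_
  obtain ⟨h1, -, h3, -⟩ := mem_blocksOf.1 hB
  obtain ⟨i, hi⟩ := h1 0
  exact Finset.notMem_empty i ((h3 i).2 ⟨0, hi⟩)

theorem blocksOf_zero {p : ℕ} {S : Finset (Fin p)} (hS : S.Nonempty) : blocksOf S 0 = ∅ := by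
  refine Finset.eq_empty_of_forall_notMem fun B hB => ?_
  obtain ⟨-, -, h3, -⟩ := mem_blocksOf.1 hB
  obtain ⟨i, hi⟩ := hS
  obtain ⟨r, -⟩ := (h3 i).1 hi
  exact r.elim0

theorem blocksOf_empty_zero {p : ℕ} : blocksOf (∅ : Finset (Fin p)) 0 = Finset.univ := by
  ext B
  simp only [mem_blocksOf, Finset.mem_univ, iff_true]
  simp

theorem snoc_mem_blocksOf {p s : ℕ} {S I : Finset (Fin p)} {m : Fin p} (h : ∀ i ∈ S, i < m)
    (hI : I ⊆ S) {B : Fin s → Finset (Fin p)} (hB : B ∈ blocksOf I s) :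
    (Fin.snoc B (insert m (S \ I)) : Fin (s + 1) → Finset (Fin p)) ∈
      blocksOf (insert m S) (s + 1) := by
  obtain ⟨h1, h2, h3, h4⟩ := mem_blocksOf.1 hB
  have hBI : ∀ r, B r ⊆ I := fun r i hi => (h3 i).2 ⟨r, hi⟩
  have hd : ∀ r, Disjoint (B r) (insert m (S \ I)) := fun r => by
    rw [Finset.disjoint_insert_right]
    exact ⟨fun hm => (h m (hI (hBI r hm))).false,
      Finset.disjoint_of_subset_left (hBI r) Finset.disjoint_sdiff⟩
  refine mem_blocksOf.2 ⟨fun r => ?_, fun r r' => ?_, fun i => ?_, fun r r' => ?_⟩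
  · refine Fin.lastCases ?_ (fun r => ?_) r
    · simp
    · simpa using h1 r
  · refine Fin.lastCases ?_ (fun r => ?_) r <;> refine Fin.lastCases ?_ (fun r' => ?_) r'
    · simp
    · simpa using fun _ => (hd r').symm
    · simpa using hd r
    · simpa using h2 r r'
  · simp only [Fin.exists_fin_succ', Fin.snoc_castSucc, Fin.snoc_last, ← h3, Finset.mem_insert,
      Finset.mem_sdiff]
    have := @hI i
    tauto
  · refine Fin.lastCases ?_ (fun r => ?_) r <;> refine Fin.lastCases ?_ (fun r' => ?_) r'
    · simp
    · exact fun hr => absurd hr (Fin.le_last _).not_gt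
    · intro _
      rw [Fin.snoc_castSucc, Fin.snoc_last]
      refine lt_of_lt_of_le ?_ (Finset.le_max (Finset.mem_insert_self _ _))
      obtain ⟨i, hi⟩ := Finset.max_of_nonempty (h1 r)
      rw [hi]
      exact WithBot.coe_lt_coe.2 (h i (hI (hBI r (Finset.mem_of_max hi))))
    · simpa using h4 r r'

/-- Since the block maxima increase, the overall maximum `m` must lie in the last block. Removing
that block leaves an admissible tuple on its complement. -/
theorem init_mem_blocksOf {p s : ℕ} {S : Finset (Fin p)} {m : Fin p} (h : ∀ i ∈ S, i < m)
    {B : Fin (s + 1) → Finset (Fin p)} (hB : B ∈ blocksOf (insert m S) (s + 1)) :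
    S \ B (Fin.last s) ⊆ S ∧ Fin.init B ∈ blocksOf (S \ B (Fin.last s)) s ∧
      insert m (S \ (S \ B (Fin.last s))) = B (Fin.last s) := by
  obtain ⟨h1, h2, h3, h4⟩ := mem_blocksOf.1 hB
  have hm : m ∈ B (Fin.last s) := by
    obtain ⟨r, hr⟩ := (h3 m).1 (Finset.mem_insert_self _ _)
    by_cases hrl : r = Fin.last s
    · rwa [← hrl]
    · exfalso
      have hlt := (Finset.le_max hr).trans_lt (h4 r _ (Fin.lt_last_iff_ne_last.2 hrl))
      obtain ⟨i, hi⟩ := Finset.max_of_nonempty (h1 (Fin.last s))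
      rw [hi, WithBot.coe_lt_coe] at hlt
      rcases Finset.mem_insert.1 ((h3 i).2 ⟨_, Finset.mem_of_max hi⟩) with rfl | hi
      exacts [hlt.false, hlt.not_gt (h i hi)]
  have hsub : B (Fin.last s) ⊆ insert m S := fun i hi => (h3 i).2 ⟨_, hi⟩
  refine ⟨Finset.sdiff_subset, mem_blocksOf.2 ⟨fun r => h1 _, fun r r' hr => h2 _ _ ?_,
    fun i => ?_, fun r r' hr => h4 _ _ (Fin.castSucc_lt_castSucc_iff.2 hr)⟩, ?_⟩
  · exact fun e => hr (Fin.castSucc_injective _ e)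
  · rw [Finset.mem_sdiff]
    constructor
    · rintro ⟨hi, hi'⟩
      obtain ⟨r, hr⟩ := (h3 i).1 (Finset.mem_insert_of_mem hi)
      have hrl : r ≠ Fin.last s := fun e => hi' (e ▸ hr)
      exact ⟨r.castPred hrl, by rwa [Fin.init, Fin.castSucc_castPred]⟩
    · rintro ⟨r, hr⟩
      have hi' : i ∉ B (Fin.last s) := fun hi' =>
        Finset.disjoint_left.1 (h2 _ _ (Fin.castSucc_lt_last r).ne) hr hi'
      refine ⟨(Finset.mem_insert.1 ((h3 i).2 ⟨_, hr⟩)).resolve_left ?_, hi'⟩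
      rintro rfl
      exact hi' hm
  · ext i
    have := @hsub i
    by_cases hi : i = m
    · subst hi; simp [hm]
    · simp only [Finset.mem_insert, Finset.mem_sdiff, hi, false_or] at this ⊢
      tauto

/-- The combinatorial form of the recursion for cohomomorphisms: choose the complement `I` of the
last block, then decompose `I`. -/
theorem sum_blocksOf_insert {M : Type*} [AddCommMonoid M] {p : ℕ} {S : Finset (Fin p)} {m : Fin p}
    (h : ∀ i ∈ S, i < m) (s : ℕ) (f : (Fin (s + 1) → Finset (Fin p)) → M) :
    ∑ B ∈ blocksOf (insert m S) (s + 1), f B =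
      ∑ I ∈ S.powerset, ∑ B ∈ blocksOf I s, f (Fin.snoc B (insert m (S \ I))) := by
  rw [Finset.sum_sigma']
  refine Finset.sum_bij' (fun B _ => ⟨S \ B (Fin.last s), Fin.init B⟩)
    (fun x _ => Fin.snoc x.2 (insert m (S \ x.1))) ?_ ?_ ?_ ?_ ?_
  · intro B hB
    obtain ⟨h1, h2, -⟩ := init_mem_blocksOf h hB
    exact Finset.mem_sigma.2 ⟨Finset.mem_powerset.2 h1, h2⟩
  · rintro ⟨I, B⟩ hx
    rw [Finset.mem_sigma, Finset.mem_powerset] at hx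
    exact snoc_mem_blocksOf h hx.1 hx.2
  · intro B hB
    change Fin.snoc (Fin.init B) (insert m (S \ (S \ B (Fin.last s)))) = B
    rw [(init_mem_blocksOf h hB).2.2, Fin.snoc_init_self]
  · rintro ⟨I, B⟩ hx
    rw [Finset.mem_sigma, Finset.mem_powerset] at hx
    have hm : m ∉ S := fun hm => (h m hm).false
    have : S \ insert m (S \ I) = I := by
      ext i
      have := @hx.1 i
      by_cases hi : i = m
      · subst hi; simp [hm]; tauto
      · simp only [Finset.mem_insert, Finset.mem_sdiff, hi, false_or]
        tauto
    simp [this]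
  · intro B hB
    change f B = f (Fin.snoc (Fin.init B) (insert m (S \ (S \ B (Fin.last s)))))
    rw [(init_mem_blocksOf h hB).2.2, Fin.snoc_init_self]

/-- The values of a cohomomorphism in terms of its corestriction. -/
theorem IsCohomomorphism.apply_subWord {𝒱 : (Fin n → ℤ) → Submodule K V}
    [DirectSum.Decomposition 𝒱] {𝒱' : (Fin n → ℤ) → Submodule K V'} [DirectSum.Decomposition 𝒱']
    {F : T K V →ₗ[K] T K V'} (hF : IsCohomomorphism 𝒱 𝒱' F) {p : ℕ} {d : Fin p → Fin n → ℤ}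
    {v : Fin p → V} (hv : ∀ i, v i ∈ 𝒱 (d i)) (N : ℕ) (S : Finset (Fin p)) (hN : S.card ≤ N) :
    F (subWord K v S) = ∑ s ∈ Finset.range N, ∑ B ∈ blocksOf S (s + 1),
      (-1 : K) ^ invSum (fun i j => d i ⬝ᵥ d j) B •
        word K V' (s + 1) fun r => pr (F (subWord K v (B r))) := by
  induction N generalizing S with
  | zero => simp [Finset.card_eq_zero.1 (Nat.le_zero.1 hN)]
  | succ N ih =>
    rcases S.eq_empty_or_nonempty with rfl | hS
    · simp [blocksOf_empty_succ]
    obtain ⟨m, S, h, rfl⟩ := exists_eq_insert_max hS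
    have hm : m ∉ S := fun hm => (h m hm).false
    rw [Finset.card_insert_of_notMem hm, Nat.add_le_add_iff_right] at hN
    rw [hF.eq_incl_add_concat, coproduct_subWord 𝒱 hv h, Finset.sum_range_succ']
    simp_rw [sum_blocksOf_insert h]
    rw [add_comm]
    congr 1
    · simp only [map_sum, map_smul, TensorProduct.map_tmul, concat_tmul]
      -- The term `I = ∅` admits no `s + 1` nonempty blocks, in agreement with its absence from the
      -- coproduct.
      rw [Finset.sum_comm, ← Finset.add_sum_erase _ _ (Finset.empty_mem_powerset S)]
      simp only [blocksOf_empty_succ, Finset.sum_empty, Finset.sum_const_zero, zero_add]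
      refine Finset.sum_congr rfl fun I hI => ?_
      have hIS := Finset.mem_powerset.1 (Finset.mem_of_mem_erase hI)
      rw [ih I ((Finset.card_le_card hIS).trans hN), map_sum, LinearMap.sum_apply,
        Finset.smul_sum]
      refine Finset.sum_congr rfl fun s _ => ?_
      rw [map_sum, LinearMap.sum_apply, Finset.smul_sum]
      refine Finset.sum_congr rfl fun B hB => ?_
      have hd : Disjoint I (insert m (S \ I)) := by
        rw [Finset.disjoint_insert_right]
        exact ⟨fun h' => hm (hIS h'), Finset.disjoint_sdiff⟩
      rw [map_smul, LinearMap.smul_apply, smul_smul, ← neg_one_zpow_add, snocT_word,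
        invSum_snoc _ B I _ (mem_blocksOf.1 hB).2.2.1 hd, crossing_insert_of_lt _
          (fun h' => hm (Finset.mem_sdiff.1 h').1) (fun i hi => h i (hIS hi)), add_comm]
      congr 2
      exact (Fin.comp_snoc (fun A => pr (F (subWord K v A))) B (insert m (S \ I))).symm
    -- For a single block only `I = ∅` contributes, and it gives the one-letter component.
    · rw [← Finset.add_sum_erase _ _ (Finset.empty_mem_powerset S), blocksOf_empty_zero,
        Finset.sum_eq_zero (s := S.powerset.erase ∅), Finset.univ_unique, Finset.sum_singleton]
      · rw [invSum_fin_one, zpow_zero, one_smul, add_zero, incl_apply,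
          word_eq_listWord]
        simp [Fin.snoc]
      · intro I hI
        rw [blocksOf_zero (Finset.nonempty_iff_ne_empty.2 (Finset.mem_erase.1 hI).1),
          Finset.sum_empty]

/-! ### Homogeneity of projections and subtuples. -/

theorem pr_mem {𝒱 : (Fin n → ℤ) → Submodule K V} {α : Fin n → ℤ} {x : T K V}
    (hx : x ∈ gradeT 𝒱 α) : pr x ∈ 𝒱 α := by
  induction hx using Submodule.span_induction with
  | mem x hx =>
    obtain ⟨p, d, v, hv, rfl, rfl⟩ := hx
    rw [word_eq_listWord]
    cases p with
    | zero =>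
      rw [List.ofFn_succ, List.ofFn_zero, ← incl_apply, pr_incl, Fin.sum_univ_one]
      exact hv 0
    | succ p =>
      rw [pr_listWord (by simp)]
      exact zero_mem _
  | zero => simp
  | add x y _ _ hx hy => rw [map_add]; exact add_mem hx hy
  | smul c x _ hx => rw [map_smul]; exact Submodule.smul_mem _ c hx

theorem append_mem {𝒱 : (Fin n → ℤ) → Submodule K V} {p q : ℕ} {d : Fin p → Fin n → ℤ}
    {d' : Fin q → Fin n → ℤ} {v : Fin p → V} {v' : Fin q → V} (hv : ∀ i, v i ∈ 𝒱 (d i))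
    (hv' : ∀ i, v' i ∈ 𝒱 (d' i)) (i : Fin (p + q)) :
    Fin.append v v' i ∈ 𝒱 (Fin.append d d' i) := by
  refine Fin.addCases (fun i => ?_) (fun i => ?_) i
  · rw [Fin.append_left, Fin.append_left]
    exact hv i
  · rw [Fin.append_right, Fin.append_right]
    exact hv' i

theorem sub_mem_sub {𝒱 : (Fin n → ℤ) → Submodule K V} {p : ℕ} {d : Fin p → Fin n → ℤ}
    {v : Fin p → V} (hv : ∀ i, v i ∈ 𝒱 (d i)) (I : Finset (Fin p)) (t : Fin I.card) :
    sub v I t ∈ 𝒱 (sub d I t) :=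
  hv _

end Coderivations

/-! ### Sign computations modulo 2 -/

section ModTwo

theorem zmod_two_mul_self (x : ZMod 2) : x * x = x := by
  revert x; decide

theorem zmod_two_eq_zero : (2 : ZMod 2) = 0 := rfl

variable {ι : Type*} [LinearOrder ι]

/-- The sum over `i ∈ S` of `a i` times the number of elements of `S` larger than `i`. -/
def laterSum {A : Type*} [AddCommMonoid A] (a : ι → A) (S : Finset ι) : A :=
  ∑ i ∈ S, ∑ j ∈ S, if i < j then a i else 0

/-- For `i ∈ I` and `j ∈ J`, a pair in order contributes `a i` and an inverted pair contributes `a j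
= (a i + a j) + a i` modulo 2. The terms `a i` sum to the last product, the corrections to the
crossing. -/
theorem laterSum_union (a : ι → ZMod 2) {I J : Finset ι} (h : Disjoint I J) :
    laterSum a (I ∪ J) = laterSum a I + laterSum a J +
      crossing (fun i j => a i + a j) I J + (∑ i ∈ I, a i) * J.card := by
  have key : (∑ i ∈ I, ∑ j ∈ J, if i < j then a i else 0) +
      (∑ j ∈ J, ∑ i ∈ I, if j < i then a j else 0) =
      crossing (fun i j => a i + a j) I J + (∑ i ∈ I, a i) * J.card := by
    rw [Finset.sum_comm (s := J), crossing, Finset.sum_mul, ← Finset.sum_add_distrib,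
      ← Finset.sum_add_distrib]
    refine Finset.sum_congr rfl fun i hi => ?_
    rw [← Finset.sum_add_distrib, mul_comm, ← nsmul_eq_mul, ← Finset.sum_const,
      ← Finset.sum_add_distrib]
    refine Finset.sum_congr rfl fun j hj => ?_
    rcases lt_trichotomy i j with hij | hij | hij
    · simp [hij, hij.not_gt]
    · exact absurd (hij ▸ hi) (Finset.disjoint_right.1 h hj)
    · simp only [hij, hij.not_gt, if_true, if_false]
      linear_combination (-a i) * zmod_two_eq_zero
  rw [laterSum, Finset.sum_union h]
  simp_rw [Finset.sum_union h, Finset.sum_add_distrib]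
  rw [laterSum, laterSum]
  linear_combination key

theorem crossing_eq_zero {A : Type*} [AddCommMonoid A] (β : ι → ι → A) {I J : Finset ι}
    (h : ∀ i ∈ I, ∀ j ∈ J, i < j) : crossing β I J = 0 :=
  Finset.sum_eq_zero fun i hi => Finset.sum_eq_zero fun j hj => if_neg (h i hi j hj).not_gt

theorem crossing_add {A : Type*} [AddCommMonoid A] (β γ : ι → ι → A) (I J : Finset ι) :
    crossing (fun i j => β i j + γ i j) I J = crossing β I J + crossing γ I J := by
  simp only [crossing, ← Finset.sum_add_distrib]
  refine Finset.sum_congr rfl fun i _ => Finset.sum_congr rfl fun j _ => ?_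
  split_ifs <;> simp

theorem intCast_crossing (β : ι → ι → ℤ) (I J : Finset ι) :
    ((crossing β I J : ℤ) : ZMod 2) = crossing (fun i j => (β i j : ZMod 2)) I J := by
  simp [crossing]

/-! ### Exponents of desuspension signs. -/

theorem e₁_dotProduct {n : ℕ} [NeZero n] (x : Fin n → ℤ) : e₁ ⬝ᵥ x = x 0 := by
  simp [e₁]

theorem e₁_apply_zero {n : ℕ} [NeZero n] : (e₁ : Fin n → ℤ) 0 = 1 := by
  simp [e₁]

/-- Compares the Koszul signs of `↓V` and `V`: the constant `1` produces the signature of the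
permutation, and the first coordinates produce the crossing in `laterSum_union`. -/
theorem sub_e₁_dotProduct {n : ℕ} [NeZero n] (x y : Fin n → ℤ) :
    (x - e₁) ⬝ᵥ (y - e₁) = x ⬝ᵥ y - y 0 - x 0 + 1 := by
  rw [sub_dotProduct, dotProduct_sub, dotProduct_sub, dotProduct_comm x e₁, e₁_dotProduct,
    e₁_dotProduct, e₁_dotProduct, e₁_apply_zero]
  ring

/-- The exponent of the sign of `↓^{⊗p}`. -/
def desuspExponent {n : ℕ} [NeZero n] {p : ℕ} (d : Fin p → Fin n → ℤ) : ℤ :=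
  ∑ s : Fin p, (((p : ℤ) - ((s : ℤ) + 1)) • (e₁ : Fin n → ℤ)) ⬝ᵥ d s

theorem desuspExponent_eq {n : ℕ} [NeZero n] {p : ℕ} (d : Fin p → Fin n → ℤ) :
    desuspExponent d = ∑ s : Fin p, ((p : ℤ) - ((s : ℤ) + 1)) * d s 0 := by
  refine Finset.sum_congr rfl fun s _ => ?_
  rw [smul_dotProduct, e₁_dotProduct, smul_eq_mul]

/-- The coefficient `p - s` counts the positions after the `s`-th one; this form makes sense for
subwords and is compatible with splittings. -/
theorem desuspExponent_eq_laterSum {n : ℕ} [NeZero n] {p : ℕ} (d : Fin p → Fin n → ℤ) :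
    desuspExponent d = laterSum (fun i => d i 0) Finset.univ := by
  rw [desuspExponent_eq, laterSum]
  refine Finset.sum_congr rfl fun s _ => ?_
  rw [← Finset.sum_filter, Finset.filter_lt_eq_Ioi, Finset.sum_const, Fin.card_Ioi, nsmul_eq_mul]
  congr 1
  have := s.isLt
  omega

theorem sum_sub_orderEmb {A : Type*} [AddCommMonoid A] {p : ℕ} (I : Finset (Fin p))
    (g : Fin p → A) : ∑ t, g (I.orderEmbOfFin rfl t) = ∑ i ∈ I, g i := by
  refine (Finset.sum_map Finset.univ (I.orderEmbOfFin rfl).toEmbedding g).symm.trans ?_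
  rw [Finset.map_orderEmbOfFin_univ]

theorem desuspExponent_sub {n : ℕ} [NeZero n] {p : ℕ} (d : Fin p → Fin n → ℤ)
    (I : Finset (Fin p)) : desuspExponent (sub d I) = laterSum (fun i => d i 0) I := by
  rw [desuspExponent_eq_laterSum, laterSum, laterSum, ← sum_sub_orderEmb I]
  refine Finset.sum_congr rfl fun t _ => ?_
  rw [← sum_sub_orderEmb I]
  simp [sub]

/-- Each letter of the first tuple gains `q` later letters. -/
theorem desuspExponent_append {n : ℕ} [NeZero n] {p q : ℕ} (d : Fin p → Fin n → ℤ)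
    (d' : Fin q → Fin n → ℤ) : desuspExponent (Fin.append d d') =
      desuspExponent d + q * ∑ i, d i 0 + desuspExponent d' := by
  simp only [desuspExponent_eq, Fin.sum_univ_add, Fin.append_left, Fin.append_right,
    Finset.mul_sum, ← Finset.sum_add_distrib]
  congr 1
  · refine Finset.sum_congr rfl fun i _ => ?_
    push_cast [Fin.val_castAdd]
    ring
  · refine Finset.sum_congr rfl fun i _ => ?_
    push_cast [Fin.val_natAdd]
    ring

theorem desuspExponent_singleton {n : ℕ} [NeZero n] (x : Fin n → ℤ) :
    desuspExponent ![x] = 0 := by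
  simp [desuspExponent]

theorem intCast_laterSum (a : ι → ℤ) (I : Finset ι) :
    ((laterSum a I : ℤ) : ZMod 2) = laterSum (fun i => (a i : ZMod 2)) I := by
  simp [laterSum]

theorem signature_cast {K : Type*} [Field K] {p s : ℕ} (B : Fin s → Finset (Fin p)) :
    (signature B : K) = (-1 : K) ^ invSum (fun _ _ => (1 : ℤ)) B := by
  simp [signature, invSum]

theorem omega_snoc {n : ℕ} [NeZero n] {p s : ℕ} (d : Fin p → Fin n → ℤ)
    (B : Fin s → Finset (Fin p)) (J : Finset (Fin p)) :
    omega d (Fin.snoc B J : Fin (s + 1) → Finset (Fin p)) =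
      omega d B + s + ∑ r, ((B r).card : ℤ) + (J.card + 1) * ∑ r, ∑ i ∈ B r, d i 0 := by
  have h1 : ((s + 1 : ℕ) : ℤ) * (((s + 1 : ℕ) : ℤ) - 1) / 2 = (s : ℤ) * ((s : ℤ) - 1) / 2 + s := by
    rw [← Int.add_mul_ediv_right _ _ (by norm_num)]
    congr 1
    push_cast
    ring
  have h2 : ∀ (r : Fin s), ∑ q ∈ Finset.univ.filter (fun q : Fin (s + 1) => q < r.castSucc),
      ∑ i ∈ (Fin.snoc B J : Fin (s + 1) → Finset (Fin p)) q, d i =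
      ∑ q ∈ Finset.univ.filter (fun q : Fin s => q < r), ∑ i ∈ B q, d i := fun r => by
    rw [Finset.sum_filter, Finset.sum_filter, Fin.sum_univ_castSucc]
    simp [(Fin.castSucc_lt_last r).not_gt]
  have h3 : ∑ q ∈ Finset.univ.filter (fun q : Fin (s + 1) => q < Fin.last s),
      ∑ i ∈ (Fin.snoc B J : Fin (s + 1) → Finset (Fin p)) q, d i = ∑ q, ∑ i ∈ B q, d i := by
    rw [Finset.sum_filter, Fin.sum_univ_castSucc]
    simp [Fin.castSucc_lt_last]
  rw [omega, omega, h1, Fin.sum_univ_castSucc, Fin.sum_univ_castSucc, h3]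
  simp only [h2, Fin.snoc_castSucc, Fin.snoc_last, Fin.val_castSucc, Fin.val_last]
  rw [smul_dotProduct (_ : ℤ) _ (∑ q, ∑ i ∈ B q, d i), e₁_dotProduct, Finset.sum_apply]
  simp only [Finset.sum_apply, smul_eq_mul]
  have h4 : ∑ r : Fin s, (((s + 1 : ℕ) : ℤ) - ((r : ℤ) + 1)) * ((B r).card : ℤ) =
      ∑ r : Fin s, ((s : ℤ) - ((r : ℤ) + 1)) * ((B r).card : ℤ) + ∑ r, ((B r).card : ℤ) := by
    rw [← Finset.sum_add_distrib]
    refine Finset.sum_congr rfl fun r _ => ?_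
    push_cast
    ring
  rw [h4]
  push_cast
  ring

/-- The sign of the terms on the left hand side of the identities. -/
theorem sign_lhs {n : ℕ} [NeZero n] {p s : ℕ} (d : Fin p → Fin n → ℤ) (S : Finset (Fin p))
    (B : Fin s → Finset (Fin p)) (hd : ∀ r r', r ≠ r' → Disjoint (B r) (B r'))
    (hS : ∀ i, i ∈ S ↔ ∃ r, i ∈ B r) :
    ((invSum (fun i j => (d i - e₁) ⬝ᵥ (d j - e₁)) B + ∑ r, desuspExponent (sub d (B r)) +
      desuspExponent (fun r => ∑ i ∈ B r, d i + (1 - ((B r).card : ℤ)) • e₁) : ℤ) : ZMod 2) =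
    ((laterSum (fun i => d i 0) S + omega d B + invSum (fun _ _ => (1 : ℤ)) B +
      koszulExponent d B : ℤ) : ZMod 2) := by
  -- Each exponent has a rule for appending a last block, so only the increments need comparing.
  induction s generalizing S with
  | zero =>
    have : S = ∅ := Finset.eq_empty_of_forall_notMem fun i hi => ((hS i).1 hi).choose.elim0
    subst this
    simp [invSum, inversions, desuspExponent, laterSum, omega, koszulExponent]
  | succ s ih =>
    obtain ⟨B, J, rfl⟩ : ∃ (B' : Fin s → Finset (Fin p)) (J : Finset (Fin p)),
        B = Fin.snoc B' J := ⟨Fin.init B, B (Fin.last s), (Fin.snoc_init_self B).symm⟩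
    have hd' : ∀ r r', r ≠ r' → Disjoint (B r) (B r') := fun r r' hr => by
      simpa using hd r.castSucc r'.castSucc fun e => hr (Fin.castSucc_injective _ e)
    have hdJ : ∀ r, Disjoint (B r) J := fun r => by
      simpa using hd r.castSucc (Fin.last s) (Fin.castSucc_lt_last r).ne
    set I := Finset.univ.biUnion B with hI
    have hIB : ∀ i, i ∈ I ↔ ∃ r, i ∈ B r := by simp [hI]
    have hIJ : Disjoint I J := (Finset.disjoint_biUnion_left _ _ _).2 fun r _ => hdJ r
    have hSIJ : S = I ∪ J := by
      ext i
      rw [hS, Finset.mem_union, hIB, Fin.exists_fin_succ']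
      simp
    have hsum : ∀ g : Fin p → ℤ, ∑ r, ∑ i ∈ B r, g i = ∑ i ∈ I, g i := fun g =>
      (Finset.sum_biUnion fun r _ r' _ hr => hd' r r' hr).symm
    have hcard : ∑ r, ((B r).card : ℤ) = I.card := by
      simpa using hsum fun _ => 1
    have ih' := ih I B hd' hIB
    -- The entry of index `r` is the degree of `f_{|I^r|}(V_{I^r})`. One more argument adds the
    -- first coordinates of all the preceding entries.
    have hdesusp : desuspExponent (fun r => ∑ i ∈ (Fin.snoc B J : Fin (s + 1) → Finset (Fin p)) r,
          d i + (1 - (((Fin.snoc B J : Fin (s + 1) → Finset (Fin p)) r).card : ℤ)) • e₁) =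
        desuspExponent (fun r => ∑ i ∈ B r, d i + (1 - ((B r).card : ℤ)) • e₁) +
          (∑ i ∈ I, d i 0 + s - I.card) := by
      rw [desuspExponent_eq, desuspExponent_eq, Fin.sum_univ_castSucc, ← hsum, ← hcard]
      simp only [Fin.snoc_castSucc, Fin.snoc_last, Fin.val_castSucc, Fin.val_last, Pi.add_apply,
        Pi.smul_apply, e₁_apply_zero, Finset.sum_apply, smul_eq_mul, mul_one]
      have : (s : ℤ) = ∑ _r : Fin s, 1 := by simp
      conv_rhs => rw [add_sub_assoc, this]
      rw [← Finset.sum_sub_distrib, ← Finset.sum_add_distrib, ← Finset.sum_add_distrib]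
      push_cast
      rw [sub_self, zero_mul, add_zero]
      refine Finset.sum_congr rfl fun r _ => ?_
      rw [← this]
      ring
    have hcr : ((crossing (fun i j => (d i - e₁) ⬝ᵥ (d j - e₁)) I J : ℤ) : ZMod 2) =
        crossing (fun i j => ((d i ⬝ᵥ d j : ℤ) : ZMod 2)) I J + crossing (fun _ _ => 1) I J +
          crossing (fun i j => ((d i 0 : ℤ) : ZMod 2) + (d j 0 : ℤ)) I J := by
      rw [intCast_crossing, ← crossing_add, ← crossing_add]
      congr 1
      ext i j
      rw [sub_e₁_dotProduct]
      push_cast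
      linear_combination (-(d i 0 : ZMod 2) - d j 0) * zmod_two_eq_zero
    rw [koszulExponent_eq_invSum] at ih' ⊢
    rw [invSum_snoc _ B I J hIB hIJ, invSum_snoc _ B I J hIB hIJ, invSum_snoc _ B I J hIB hIJ,
      omega_snoc, hdesusp, hcard, hsum, Fin.sum_univ_castSucc, hSIJ]
    simp only [desuspExponent_sub, Fin.snoc_castSucc, Fin.snoc_last] at ih' ⊢
    push_cast at ih' ⊢
    rw [hcr, intCast_laterSum, intCast_laterSum, laterSum_union _ hIJ, intCast_crossing,
      intCast_crossing]
    rw [intCast_laterSum] at ih'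
    push_cast
    linear_combination ih' - ((∑ i ∈ I, (d i 0 : ZMod 2)) * J.card + I.card) * zmod_two_eq_zero

/-- The sign of the terms on the right hand side of the identities. -/
theorem sign_rhs {n : ℕ} [NeZero n] {p : ℕ} (d : Fin p → Fin n → ℤ) (k : Fin p)
    {I : Finset (Fin p)} (hI : I ⊆ Finset.Iio k) :
    ((e₁ ⬝ᵥ ∑ i ∈ I, (d i - e₁) +
      crossing (fun i j => (d i - e₁) ⬝ᵥ (d j - e₁)) I (Finset.Iio k \ I) +
      desuspExponent (Fin.append (sub d (Finset.Iio k \ I)) ![d k]) +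
      desuspExponent (Fin.append (Fin.append (sub d I)
        ![∑ i ∈ Finset.Iio k \ I, d i + d k + (1 - ((Finset.Iio k \ I).card : ℤ)) • e₁])
        (sub d (Finset.Ioi k))) : ℤ) : ZMod 2) =
    ((laterSum (fun i => d i 0) Finset.univ + lambda d I (Finset.Iio k \ I) +
      invSum (fun _ _ => (1 : ℤ)) ![Finset.Iio k \ I, I] +
      koszulExponent d ![I, Finset.Iio k \ I] : ℤ) : ZMod 2) := by
  set J := Finset.Iio k \ I with hJ
  have hIJ : Disjoint I J := Finset.disjoint_sdiff
  have hIJk : I ∪ J = Finset.Iio k := Finset.union_sdiff_of_subset hI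
  have hk : Disjoint {k} (Finset.Ioi k) := by simp
  have hall : Disjoint (Finset.Iio k) ({k} ∪ Finset.Ioi k) := by
    rw [Finset.disjoint_left]
    intro i hi hi'
    simp only [Finset.mem_Iio, Finset.mem_union, Finset.mem_singleton, Finset.mem_Ioi] at hi hi'
    omega
  have huniv : (Finset.univ : Finset (Fin p)) = Finset.Iio k ∪ ({k} ∪ Finset.Ioi k) := by
    ext i
    simp only [Finset.mem_univ, Finset.mem_Iio, Finset.mem_union, Finset.mem_singleton,
      Finset.mem_Ioi, true_iff]
    omega
  have hp : (p : ZMod 2) = I.card + J.card + 1 + (Finset.Ioi k).card := by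
    have := congrArg Finset.card huniv
    rw [Finset.card_union_of_disjoint hall, Finset.card_union_of_disjoint hk, ← hIJk,
      Finset.card_union_of_disjoint hIJ, Finset.card_fin, Finset.card_singleton] at this
    refine (congrArg (Nat.cast : ℕ → ZMod 2) this).trans ?_
    push_cast
    ring
  have hcr : ((crossing (fun i j => (d i - e₁) ⬝ᵥ (d j - e₁)) I J : ℤ) : ZMod 2) =
      crossing (fun i j => ((d i ⬝ᵥ d j : ℤ) : ZMod 2)) I J + crossing (fun _ _ => 1) I J +
        crossing (fun i j => ((d i 0 : ℤ) : ZMod 2) + (d j 0 : ℤ)) I J := by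
    rw [intCast_crossing, ← crossing_add, ← crossing_add]
    congr 1
    ext i j
    rw [sub_e₁_dotProduct]
    push_cast
    linear_combination (-(d i 0 : ZMod 2) - d j 0) * zmod_two_eq_zero
  -- The common sign is decomposed along `I`, `J`, `{k}` and the letters after `k`; only `I` and `J`
  -- interleave.
  have hlater : laterSum (fun i => ((d i 0 : ℤ) : ZMod 2)) Finset.univ =
      laterSum (fun i => ((d i 0 : ℤ) : ZMod 2)) I +
      laterSum (fun i => ((d i 0 : ℤ) : ZMod 2)) J +
      crossing (fun i j => ((d i 0 : ℤ) : ZMod 2) + (d j 0 : ℤ)) I J +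
      (∑ i ∈ I, ((d i 0 : ℤ) : ZMod 2)) * J.card +
      (laterSum (fun i => ((d i 0 : ℤ) : ZMod 2)) (Finset.Ioi k) +
        d k 0 * (Finset.Ioi k).card) +
      (∑ i ∈ I, ((d i 0 : ℤ) : ZMod 2) + ∑ i ∈ J, ((d i 0 : ℤ) : ZMod 2)) *
        (1 + (Finset.Ioi k).card) := by
    rw [huniv, laterSum_union _ hall, laterSum_union _ hk, ← hIJk, laterSum_union _ hIJ,
      crossing_eq_zero _ (I := {k}), crossing_eq_zero _ (I := I ∪ J), Finset.sum_union hIJ,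
      Finset.card_union_of_disjoint hk]
    · simp [laterSum]
    · intro i hi j hj
      rw [hIJk, Finset.mem_Iio] at hi
      simp only [Finset.mem_union, Finset.mem_singleton, Finset.mem_Ioi] at hj
      omega
    · simp
  -- The identity uses the signature of `(J; I)` but the Koszul sign of `(I; J)`; the two signatures
  -- differ by `|I||J|`.
  have hJI : crossing (fun _ _ => (1 : ZMod 2)) J I =
      I.card * J.card - crossing (fun _ _ => (1 : ZMod 2)) I J := by
    have := crossing_add_crossing (fun _ _ => (1 : ZMod 2)) (fun _ _ => rfl) hIJ
    simp only [Finset.sum_const, nsmul_eq_mul, mul_one] at this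
    linear_combination this
  have hsum : ∀ (A : Finset (Fin p)), ∑ t, sub d A t 0 = ∑ i ∈ A, d i 0 := fun A =>
    sum_sub_orderEmb A fun i => d i 0
  have hsq := zmod_two_mul_self (J.card : ZMod 2)
  rw [desuspExponent_append, desuspExponent_append, desuspExponent_append, Fin.sum_univ_add,
    desuspExponent_singleton, desuspExponent_singleton, desuspExponent_sub, desuspExponent_sub,
    desuspExponent_sub, invSum_pair _ hIJ.symm, koszulExponent_eq_invSum, invSum_pair _ hIJ,
    lambda, smul_dotProduct, e₁_dotProduct, e₁_dotProduct]
  simp only [Fin.append_left, Fin.append_right, hsum, Pi.add_apply, Finset.sum_apply,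
    Pi.smul_apply, e₁_apply_zero, Pi.sub_apply, Finset.sum_sub_distrib, Finset.sum_const,
    smul_eq_mul, mul_one, Finset.univ_unique, Finset.card_singleton, Nat.cast_one, one_mul,
    Matrix.cons_val_fin_one, nsmul_eq_mul]
  push_cast
  rw [hcr, intCast_laterSum, intCast_laterSum, intCast_laterSum, intCast_laterSum, hlater,
    intCast_crossing, intCast_crossing]
  push_cast
  rw [hJI, hp]
  linear_combination hsq + (-1 - (∑ i ∈ I, (d i 0 : ZMod 2)) * J.card - I.card -
    I.card * J.card + crossing (fun _ _ => (1 : ZMod 2)) I J - (Finset.Ioi k).card * J.card -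
    J.card - J.card ^ 2) * zmod_two_eq_zero

end ModTwo

/-! ### Translation to sequences of multilinear maps -/

section Sequences

variable {K : Type*} [Field K] {n : ℕ} [NeZero n]
  {V : Type*} [AddCommGroup V] [Module K V]
  {V' : Type*} [AddCommGroup V'] [Module K V']

theorem neg_one_zpow_mul_self (z : ℤ) : (-1 : K) ^ z * (-1 : K) ^ z = 1 := by
  rw [← mul_zpow]
  simp

theorem neg_one_zpow_smul_injective {M : Type*} [AddCommGroup M] [Module K M] (z : ℤ) {x y : M}
    (h : (-1 : K) ^ z • x = (-1 : K) ^ z • y) : x = y := by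
  simpa [smul_smul, neg_one_zpow_mul_self] using congrArg (fun t => (-1 : K) ^ z • t) h

theorem desuspWord_apply (𝒱 : (Fin n → ℤ) → Submodule K V) [DirectSum.Decomposition 𝒱] {p : ℕ}
    {d : Fin p → Fin n → ℤ} {v : Fin p → V} (hv : ∀ i, v i ∈ 𝒱 (d i)) :
    desuspWord 𝒱 p v = (-1 : K) ^ desuspExponent d • word K V p v := by
  rw [desuspWord, gradedLift_apply 𝒱 _ d v hv, smul_apply]
  rfl

theorem toSeq_apply (𝒱 : (Fin n → ℤ) → Submodule K V) [DirectSum.Decomposition 𝒱]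
    (G : T K V →ₗ[K] T K V') {p : ℕ} {d : Fin (p + 1) → Fin n → ℤ} {v : Fin (p + 1) → V}
    (hv : ∀ i, v i ∈ 𝒱 (d i)) :
    toSeq 𝒱 G p v = (-1 : K) ^ desuspExponent d • pr (G (word K V (p + 1) v)) := by
  rw [toSeq, LinearMap.compMultilinearMap_apply, desuspWord_apply 𝒱 hv, map_smul]
  rfl

theorem pr_apply_word (𝒱 : (Fin n → ℤ) → Submodule K V) [DirectSum.Decomposition 𝒱]
    (G : T K V →ₗ[K] T K V') {m : ℕ} {d : Fin m → Fin n → ℤ} {v : Fin m → V}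
    (hv : ∀ i, v i ∈ 𝒱 (d i)) :
    pr (G (word K V m v)) = (-1 : K) ^ desuspExponent d • ev (toSeq 𝒱 G) m v := by
  cases m with
  | zero => simp [word, ev]
  | succ p => rw [ev, toSeq_apply 𝒱 G hv, smul_smul, neg_one_zpow_mul_self, one_smul]

theorem pr_comp_eq_of_toSeq_eq {𝒱 : (Fin n → ℤ) → Submodule K V} [DirectSum.Decomposition 𝒱]
    {F G : T K V →ₗ[K] T K V'} (h : toSeq 𝒱 F = toSeq 𝒱 G) : pr ∘ₗ F = pr ∘ₗ G :=
  hom_ext_homogeneous 𝒱 fun p d v hv => by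
    rw [LinearMap.comp_apply, LinearMap.comp_apply, pr_apply_word 𝒱 F hv, h,
      ← pr_apply_word 𝒱 G hv]

theorem mem_desusp_sub {𝒱 : (Fin n → ℤ) → Submodule K V} {α : Fin n → ℤ} {a : V}
    (ha : a ∈ 𝒱 α) : a ∈ desusp 𝒱 (α - e₁) := by
  rwa [desusp, sub_add_cancel]

/-- Each input loses an `e₁` on passing to `↓V` and the single output regains one, which accounts
for the weight `(1 - |S|) e₁`. -/
theorem pr_apply_subWord_mem {𝒱 : (Fin n → ℤ) → Submodule K V}
    {𝒱' : (Fin n → ℤ) → Submodule K V'} {w : Fin n → ℤ} {G : T K V →ₗ[K] T K V'}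
    (hG : HasWeight (desusp 𝒱) (desusp 𝒱') w G) {ι : Type*} [LinearOrder ι] {d : ι → Fin n → ℤ}
    {v : ι → V} (hv : ∀ i, v i ∈ 𝒱 (d i)) (S : Finset ι) :
    pr (G (subWord K v S)) ∈ 𝒱' (∑ i ∈ S, d i + (1 - (S.card : ℤ)) • e₁ + w) := by
  have h := pr_mem (hG _ _ (subWord_mem_gradeT (𝒱 := desusp 𝒱) (K := K)
    (fun i => mem_desusp_sub (hv i)) S))
  rw [desusp] at h
  convert h using 2
  rw [Finset.sum_sub_distrib, Finset.sum_const, sub_smul, one_smul, natCast_zsmul]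
  abel

theorem hasSeqWeight_toSeq {𝒱 : (Fin n → ℤ) → Submodule K V} [DirectSum.Decomposition 𝒱]
    {𝒱' : (Fin n → ℤ) → Submodule K V'} {G : T K V →ₗ[K] T K V'}
    (hG : HasWeight (desusp 𝒱) (desusp 𝒱') 0 G) : HasSeqWeight 𝒱 𝒱' (toSeq 𝒱 G) := by
  intro p d v hv
  rw [toSeq_apply 𝒱 G hv, ← subWord_univ]
  have := pr_apply_subWord_mem hG hv Finset.univ
  rw [add_zero, Finset.card_fin] at this
  push_cast at this
  exact Submodule.smul_mem _ _ this

theorem pr_apply_subWord (𝒱 : (Fin n → ℤ) → Submodule K V) [DirectSum.Decomposition 𝒱]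
    (G : T K V →ₗ[K] T K V') {p : ℕ} {d : Fin p → Fin n → ℤ} {v : Fin p → V}
    (hv : ∀ i, v i ∈ 𝒱 (d i)) (S : Finset (Fin p)) :
    pr (G (subWord K v S)) =
      (-1 : K) ^ desuspExponent (sub d S) • ev (toSeq 𝒱 G) S.card (sub v S) := by
  rw [← word_sub, pr_apply_word 𝒱 G (sub_mem_sub hv S)]

theorem prod_neg_one_zpow {s : ℕ} (z : Fin s → ℤ) :
    ∏ r, (-1 : K) ^ z r = (-1 : K) ^ ∑ r, z r := by
  induction s with
  | zero => simp
  | succ s ih => rw [Fin.prod_univ_succ, Fin.sum_univ_succ, neg_one_zpow_add, ih]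

/-- Three signs meet here: the Koszul sign in `↓V`, the desuspensions inside the blocks, and the
desuspension of the block outputs. `sign_lhs` combines them, extracting a factor independent of the
decomposition. -/
theorem pr_comp_cohomomorphism {𝒱 : (Fin n → ℤ) → Submodule K V} [DirectSum.Decomposition 𝒱]
    {𝒱' : (Fin n → ℤ) → Submodule K V'} [DirectSum.Decomposition 𝒱'] {F : T K V →ₗ[K] T K V'}
    (hF : IsCohomomorphism (desusp 𝒱) (desusp 𝒱') F) (Q' : T K V' →ₗ[K] T K V') {p : ℕ}
    {d : Fin p → Fin n → ℤ} {v : Fin p → V} (hv : ∀ i, v i ∈ 𝒱 (d i)) :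
    pr (Q' (F (word K V p v))) =
      (-1 : K) ^ desuspExponent d • lhs (toSeq 𝒱 F) (toSeq 𝒱' Q') d v := by
  rw [← subWord_univ, hF.apply_subWord (fun i => mem_desusp_sub (hv i)) p Finset.univ (by simp),
    lhs, map_sum, map_sum, Finset.smul_sum]
  have hIcc : Finset.Icc 1 p =
      (Finset.range p).map ⟨(· + 1), add_left_injective 1⟩ := by
    ext s
    simp only [Finset.mem_Icc, Finset.mem_map, Finset.mem_range, Function.Embedding.coeFn_mk]
    exact ⟨fun h => ⟨s - 1, by omega, by omega⟩, by rintro ⟨r, h, rfl⟩; omega⟩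
  rw [hIcc, Finset.sum_map]
  refine Finset.sum_congr rfl fun s _ => ?_
  rw [map_sum, map_sum, Finset.smul_sum, Function.Embedding.coeFn_mk, blocks_eq_blocksOf]
  refine Finset.sum_congr rfl fun B hB => ?_
  obtain ⟨-, hd, hS, -⟩ := mem_blocksOf.1 hB
  have hmem : ∀ r, ev (toSeq 𝒱 F) (B r).card (sub v (B r)) ∈
      𝒱' (∑ i ∈ B r, d i + (1 - ((B r).card : ℤ)) • e₁) := fun r => by
    have h := pr_apply_subWord_mem hF.hasWeight hv (B r)
    rw [pr_apply_subWord 𝒱 F hv, add_zero] at h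
    have h' := Submodule.smul_mem _ ((-1 : K) ^ desuspExponent (sub d (B r))) h
    rwa [smul_smul, neg_one_zpow_mul_self, one_smul] at h'
  simp_rw [pr_apply_subWord 𝒱 F hv]
  rw [MultilinearMap.map_smul_univ, prod_neg_one_zpow]
  simp only [map_smul]
  rw [pr_apply_word 𝒱' Q' hmem, smul_smul, smul_smul, smul_smul]
  congr 1
  rw [signature_cast, ← neg_one_zpow_add, ← neg_one_zpow_add, ← neg_one_zpow_add,
    ← neg_one_zpow_add, ← neg_one_zpow_add, desuspExponent_eq_laterSum d]
  have := neg_one_zpow_congr (K := K) (sign_lhs d Finset.univ B hd hS)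
  rw [← add_assoc, ← add_assoc]
  exact this

theorem map_append_smul {M : Type*} [AddCommGroup M] [Module K M] {p q : ℕ}
    (g : MultilinearMap K (fun _ : Fin (p + 1 + q) => V) M) (u : Fin p → V) (w : Fin q → V) (c : K)
    (y : V) : g (Fin.append (Fin.append u ![c • y]) w) =
      c • g (Fin.append (Fin.append u ![y]) w) := by
  have h : ∀ z, Fin.append (Fin.append u ![z]) w = Function.update
      (Fin.append (Fin.append u ![0]) w) (Fin.castAdd q (Fin.natAdd p 0)) z := by
    intro z
    ext t
    refine Fin.addCases (fun t => Fin.addCases (fun t => ?_) (fun t => ?_) t) (fun t => ?_) t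
    · rw [Function.update_of_ne (by simp [Fin.ext_iff]; omega)]
      simp
    · rw [Function.update_of_ne (by simp [Fin.ext_iff]; omega)]
      simp
    · rw [Subsingleton.elim t 0]
      simp
  rw [h, MultilinearMap.map_update_smul, ← h]

theorem sort_append_eq_ofFn {α : Type*} {p : ℕ} (v : Fin p → α) (I J : Finset (Fin p)) (x : α) :
    I.sort.map v ++ [x] ++ J.sort.map v =
      List.ofFn (Fin.append (Fin.append (sub v I) ![x]) (sub v J)) := by
  rw [List.ofFn_fin_append, List.ofFn_fin_append, ofFn_sub, ofFn_sub]
  simp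

/-- The signs come from moving `Q` past `V_I`, from the Koszul sign in `↓V`, and from the inner and
outer desuspensions. `sign_rhs` extracts the same factor as on the cohomomorphism side. -/
theorem pr_comp_coderivation {𝒱 : (Fin n → ℤ) → Submodule K V} [DirectSum.Decomposition 𝒱]
    {Q : T K V →ₗ[K] T K V} (hQ : IsCoderivation (desusp 𝒱) e₁ Q) (F : T K V →ₗ[K] T K V') {p : ℕ}
    {d : Fin p → Fin n → ℤ} {v : Fin p → V} (hv : ∀ i, v i ∈ 𝒱 (d i)) :
    pr (F (Q (word K V p v))) =
      (-1 : K) ^ desuspExponent d • rhs (toSeq 𝒱 F) (toSeq 𝒱 Q) d v := by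
  rw [← subWord_univ, hQ.apply_subWord (fun i => mem_desusp_sub (hv i)) Finset.univ,
    rhs, map_sum, map_sum, Finset.smul_sum]
  refine Finset.sum_congr rfl fun k _ => ?_
  rw [map_sum, map_sum, Finset.smul_sum, Finset.filter_gt_eq_Iio, Finset.filter_lt_eq_Ioi]
  refine Finset.sum_congr rfl fun I hI => ?_
  set J := Finset.Iio k \ I with hJ
  have hkJ : ∀ i ∈ J, i < k := fun i hi => Finset.mem_Iio.1 (Finset.mem_sdiff.1 hi).1
  have hkJ' : k ∉ J := fun h => (hkJ k h).false
  have hword : subWord K v (insert k J) = word K V (J.card + 1) (Fin.append (sub v J) ![v k]) := by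
    rw [word_eq_listWord, List.ofFn_fin_append, ofFn_sub, subWord, sort_insert_max hkJ]
    simp
  have hvJ : ∀ t, Fin.append (sub v J) ![v k] t ∈ 𝒱 (Fin.append (sub d J) ![d k] t) :=
    append_mem (sub_mem_sub hv J) (by simpa using hv k)
  set y := ev (toSeq 𝒱 Q) (J.card + 1) (Fin.append (sub v J) ![v k]) with hy
  have hq : pr (Q (subWord K v (insert k J))) =
      (-1 : K) ^ desuspExponent (Fin.append (sub d J) ![d k]) • y := by
    rw [hword, pr_apply_word 𝒱 Q hvJ]
  have hymem : y ∈ 𝒱 (∑ i ∈ J, d i + d k + (1 - (J.card : ℤ)) • e₁) := by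
    have h := pr_apply_subWord_mem hQ.hasWeight hv (insert k J)
    rw [hq] at h
    have h' := Submodule.smul_mem _ ((-1 : K) ^ desuspExponent (Fin.append (sub d J) ![d k])) h
    rw [smul_smul, neg_one_zpow_mul_self, one_smul] at h'
    convert h' using 2
    rw [Finset.sum_insert hkJ', Finset.card_insert_of_notMem hkJ', sub_smul, sub_smul, one_smul]
    push_cast
    rw [add_smul, one_smul]
    abel
  have hfull : ∀ t, Fin.append (Fin.append (sub v I) ![y]) (sub v (Finset.Ioi k)) t ∈
      𝒱 (Fin.append (Fin.append (sub d I) ![∑ i ∈ J, d i + d k + (1 - (J.card : ℤ)) • e₁])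
        (sub d (Finset.Ioi k)) t) :=
    append_mem (append_mem (sub_mem_sub hv I) fun t => by
      rw [Matrix.cons_val_fin_one, Matrix.cons_val_fin_one]; exact hymem) (sub_mem_sub hv _)
  rw [hq, sort_append_eq_ofFn, ← word_eq_listWord, map_append_smul]
  simp only [map_smul]
  rw [pr_apply_word 𝒱 F hfull, smul_smul, smul_smul, smul_smul]
  congr 1
  rw [signature_cast, ← neg_one_zpow_add, ← neg_one_zpow_add, ← neg_one_zpow_add,
    ← neg_one_zpow_add, ← neg_one_zpow_add, desuspExponent_eq_laterSum d]
  have := neg_one_zpow_congr (K := K) (sign_rhs d k (Finset.mem_powerset.1 hI))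
  rw [← add_assoc, ← add_assoc]
  exact this

/-- Both corestrictions equal the same invertible sign times the respective side of the identity, so
that sign cancels. -/
theorem pr_comp_eq_iff_satisfiesIdentities {𝒱 : (Fin n → ℤ) → Submodule K V}
    [DirectSum.Decomposition 𝒱] {𝒱' : (Fin n → ℤ) → Submodule K V'} [DirectSum.Decomposition 𝒱']
    {Q : T K V →ₗ[K] T K V} (hQ : IsCoderivation (desusp 𝒱) e₁ Q) (Q' : T K V' →ₗ[K] T K V')
    {F : T K V →ₗ[K] T K V'} (hF : IsCohomomorphism (desusp 𝒱) (desusp 𝒱') F) :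
    pr ∘ₗ Q' ∘ₗ F = pr ∘ₗ F ∘ₗ Q ↔
      SatisfiesIdentities 𝒱 (toSeq 𝒱 F) (toSeq 𝒱 Q) (toSeq 𝒱' Q') := by
  refine ⟨fun h p _ d v hv => ?_, fun h => hom_ext_homogeneous 𝒱 fun p d v hv => ?_⟩
  · have hw := LinearMap.congr_fun h (word K V p v)
    simp only [LinearMap.comp_apply] at hw
    rw [pr_comp_cohomomorphism hF Q' hv, pr_comp_coderivation hQ F hv] at hw
    exact neg_one_zpow_smul_injective _ hw
  · simp only [LinearMap.comp_apply]
    rw [pr_comp_cohomomorphism hF Q' hv, pr_comp_coderivation hQ F hv,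
      h (p + 1) (Nat.succ_pos p) d v hv]

/-- The linear map `T(↓V) → ↓V'` of a sequence of multilinear maps. -/
noncomputable def corestriction (𝒱 : (Fin n → ℤ) → Submodule K V) [DirectSum.Decomposition 𝒱]
    (f : MultiSeq K V V') : T K V →ₗ[K] V' :=
  tlift fun p => gradedLift 𝒱 fun d => (-1 : K) ^ desuspExponent d • f p

theorem corestriction_word (𝒱 : (Fin n → ℤ) → Submodule K V) [DirectSum.Decomposition 𝒱]
    (f : MultiSeq K V V') {p : ℕ} {d : Fin (p + 1) → Fin n → ℤ} {v : Fin (p + 1) → V}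
    (hv : ∀ i, v i ∈ 𝒱 (d i)) :
    corestriction 𝒱 f (word K V (p + 1) v) = (-1 : K) ^ desuspExponent d • f p v := by
  rw [corestriction, tlift_word, gradedLift_apply 𝒱 _ d v hv, smul_apply]

theorem corestriction_mem {𝒱 : (Fin n → ℤ) → Submodule K V} [DirectSum.Decomposition 𝒱]
    {𝒱' : (Fin n → ℤ) → Submodule K V'} {f : MultiSeq K V V'} (hf : HasSeqWeight 𝒱 𝒱' f) :
    ∀ α, ∀ x ∈ gradeT (desusp 𝒱) α, corestriction 𝒱 f x ∈ desusp 𝒱' α := by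
  intro α x hx
  induction hx using Submodule.span_induction with
  | mem x hx =>
    obtain ⟨p, d, v, hv, rfl, rfl⟩ := hx
    -- A letter of degree `d i` in `↓V` has degree `d i + e₁` in `V`.
    rw [corestriction_word 𝒱 f (d := fun i => d i + e₁) hv]
    refine Submodule.smul_mem _ _ ?_
    have h := hf p (fun i => d i + e₁) v hv
    rw [desusp]
    convert h using 2
    rw [Finset.sum_add_distrib, Finset.sum_const, Finset.card_fin, sub_smul, ← natCast_zsmul]
    push_cast
    rw [one_smul]
    abel
  | zero => simp
  | add x y _ _ hx hy => rw [map_add]; exact add_mem hx hy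
  | smul c x _ hx => rw [map_smul]; exact Submodule.smul_mem _ c hx

theorem toSeq_eq_of_pr_comp_eq (𝒱 : (Fin n → ℤ) → Submodule K V) [DirectSum.Decomposition 𝒱]
    {F : T K V →ₗ[K] T K V'} {f : MultiSeq K V V'} (h : pr ∘ₗ F = corestriction 𝒱 f) :
    toSeq 𝒱 F = f := by
  funext p
  refine multilinear_ext_homogeneous 𝒱 fun d v hv => ?_
  rw [toSeq_apply 𝒱 F hv, ← LinearMap.comp_apply (f := pr), h, corestriction_word 𝒱 f hv, smul_smul,
    neg_one_zpow_mul_self, one_smul]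

end Sequences
end LodayInfinity

/-! ### The bijection. -/

theorem mainTheorem9 {K : Type*} [Field K] [CharZero K] {n : ℕ} [NeZero n]
    {V : Type*} [AddCommGroup V] [Module K V]
    {V' : Type*} [AddCommGroup V'] [Module K V']
    (𝒱 : (Fin n → ℤ) → Submodule K V) [DirectSum.Decomposition 𝒱]
    (𝒱' : (Fin n → ℤ) → Submodule K V') [DirectSum.Decomposition 𝒱']
    (L : LodayInfinity.LodStructure 𝒱) (L' : LodayInfinity.LodStructure 𝒱') :
    Set.BijOn (fun F : LodayInfinity.T K V →ₗ[K] LodayInfinity.T K V' => LodayInfinity.toSeq 𝒱 F)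
      {F | LodayInfinity.IsLodMorphism L L' F}
      {f | LodayInfinity.HasSeqWeight 𝒱 𝒱' f ∧
        LodayInfinity.SatisfiesIdentities 𝒱 f L.π L'.π} := by
  open LodayInfinity in
  refine ⟨fun F hF => ⟨hasSeqWeight_toSeq hF.isCohomomorphism.hasWeight, ?_⟩,
    fun F hF G hG h => hF.isCohomomorphism.ext hG.isCohomomorphism (pr_comp_eq_of_toSeq_eq h),
    fun f hf => ?_⟩
  · exact (pr_comp_eq_iff_satisfiesIdentities L.isCoderivation L'.Q hF.isCohomomorphism).1
      (by rw [hF.intertwines])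
  -- Surjectivity: the preimage of `f` is the cohomomorphism cofreely generated by the corestriction
  -- that `f` defines on `T(↓V)`.
  · have hF := isCohomomorphism_cohomLift (corestriction_mem hf.1)
    have hf' := toSeq_eq_of_pr_comp_eq 𝒱 (pr_cohomLift (desusp 𝒱) (corestriction 𝒱 f))
    refine ⟨_, ⟨hF, hF.intertwines L.isCoderivation L'.isCoderivation ?_⟩, hf'⟩
    refine (pr_comp_eq_iff_satisfiesIdentities L.isCoderivation L'.Q hF).2 ?_
    rw [hf']
    exact hf.2
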